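/- **Setting.** Fix a finite set $G$ with an involution $\sigma$ and an integer $q\ge 0$. Consider finite simple graphs whose directed edges are colored by elements of $G$, the color of the reversed edge being the image of the color under $\sigma$, and in which at most $q$ edges end at any vertex. Let $\mathrm{Conf}$ be the set of their isomorphism classes, a commutative monoid under disjoint union with unit $1=[\emptyset]$, and let $\mathrm{Conf}_0$ be the subset of (nonempty) connected classes; $\#S$ is the number of vertices. "Subgraph" means full subgraph. Let $\mathbb{R}[[\mathrm{Conf}]]$ be the algebra of all formal series $\sum_{S\in\mathrm{Conf}} f_S\,S$. For $m\ge0$ let $$\Phi_m\Big(\sum_U f_U U\Big)=\sum_{S_1,\dots,S_m}\Big(\sum_U \tbinom{U}{S_1,\dots,S_m}f_U\Big)S_1\otimes\cdots\otimes S_m ,$$ where $\binom{U}{S_1,\dots,S_m}$ is the number of $m$-tuples of subgraphs of a representative of $U$, of types $S_1,\dots,S_m$, that together cover all its vertices. Let $\mathcal{L}_{\mathbb R}\subset\mathbb{R}[[\mathrm{Conf}]]$ be the space of Lie-like elements, i.e. of the $f$ with $\Phi_m(f)=\sum_{i=1}^m 1\otimes\cdots\otimes f\otimes\cdots\otimes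 1$ ($f$ at the $i$-th place) for all $m\ge0$. It carries the classical topology: the projective limit topology of its finite-dimensional quotients by the subspaces of elements having only terms of degree $\#S\ge n$, $n\ge 0$. For $T\in \mathrm{Conf}$ let $\mathcal{A}(T)=\sum_S A(S,T)\,S$, where $A(S,T)$ is the number of subgraphs of $T$ of type $S$, and let $\mathcal{M}(T)=\log\mathcal{A}(T)=\sum_S M(S,T)\,S$. For $S,T\in\mathrm{Conf}_0$ let $K(T,S)$ be the number of subgraphs of $S$ of type $T$ such that every vertex of $S$ outside the subgraph is adjacent to a vertex of it. The kabi map $\overline K:\mathcal{L}_{\mathbb R}\to\prod_{T\in\mathrm{Conf}_0}\mathbb{R}\cdot\mathcal{M}(T)$ sends a Lie-like element $f$ to the family whose coefficient at $\mathcal{M}(T)$ is the (finite) sum $\sum_{S\in\mathrm{Conf}_0}(-1)^{\#T-\#S}K(T,S)\,f_S$. Put $\mathcal{L}_{\mathbb R,\infty}=\ker\overline K$. A formal sum $\sum_{T\in\mathrm{Conf}_0}a_T\mathcal{M}(T)$ with real coefficients $a_T$ is absolutely convergent if $\sum_T|a_TM(S,T)|<\infty$ for all $S\in\mathrm{Conf}$;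 its coefficientwise sum is then denoted by $\sum^{abs}_T a_T\mathcal{M}(T)$. Let $\mathcal{L}_{\mathbb R,abs}\subset\mathcal{L}_{\mathbb R}$ be the space of Lie-like elements that are such sums. Let $\Omega$ be the closure in $\mathcal{L}_{\mathbb R}$ of the set $\{\mathcal{M}(T)/\#T \mid T\in\mathrm{Conf},\ T\ne[\emptyset]\}$, and put $\Omega_{abs}=\Omega\cap\mathcal{L}_{\mathbb R,abs}$ and $\Omega_\infty=\Omega\cap\mathcal{L}_{\mathbb R,\infty}$. The join $A*B$ of two sets is $\{\lambda p+(1-\lambda)r\mid p\in A,\ r\in B,\ \lambda\in[0,1]\}$ if both are nonempty, and $A*\emptyset=A$, $\emptyset*B=B$. **Lemma.** Every $\mathcal{M}(T)$ with $T\in\mathrm{Conf}$ is Lie-like, the set $\Omega$ is compact and convex, $\mathcal{L}_{\mathbb R,abs}\cap\mathcal{L}_{\mathbb R,\infty}=\{0\}$, and: 1. $\Omega$ is the join of its finite part and its infinite part: $\Omega=\Omega_{abs}*\Omega_\infty$. 2. The finite part is the infinite simplex with the vertices $\mathcal{M}(S)/\#S$, $S\in\mathrm{Conf}_0$: $$\Omega_{abs}=\Big\{\textstyle\sum^{abs}_{S\in\mathrm{Conf}_0}\mu_S\,\frac{\mathcal{M}(S)}{\#S}\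 \Big|\ \mu_S\in\mathbb{R}_{\ge0},\ \sum_{S\in\mathrm{Conf}_0}\mu_S=1\Big\}.$$ Here the sum converges absolutely, to a Lie-like element, for every family $(\mu_S)$ of nonnegative reals with total sum $1$, and each element of $\Omega_{abs}$ determines its family $(\mu_S)$ uniquely. -/

import Mathlib

universe u

/-- A `(G, σ)`-colored graph on the vertex set `V`: a simple graph together with a map from its
directed edges to the color set `G` which is equivariant for the reversal of directed edges and
the involution `σ`. -/
structure ColoredGraph {G : Type u} (σ : G → G) (V : Type) where
  graph : SimpleGraph V
  color : ∀ x y : V, graph.Adj x y → G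
  color_symm : ∀ (x y : V) (h : graph.Adj x y), color y x h.symm = σ (color x y h)

/-- A finite `(G, σ)`-colored graph in which at most `q` edges end at any vertex. -/
structure FinGraph {G : Type u} (σ : G → G) (q : ℕ) where
  V : Type
  fin : Finite V
  toColored : ColoredGraph σ V
  valency_le : ∀ x : V, (toColored.graph.neighborSet x).ncard ≤ q

namespace FinGraph

variable {G : Type u} {σ : G → G} {q : ℕ}

instance (Γ : FinGraph σ q) : Finite Γ.V := Γ.fin

/-- Adjacency of vertices. -/
def Adj (Γ : FinGraph σ q) (x y : Γ.V) : Prop := Γ.toColored.graph.Adj x y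

/-- Color preserving isomorphism of graphs. -/
def Iso (Γ Δ : FinGraph σ q) : Prop :=
  ∃ e : Γ.toColored.graph ≃g Δ.toColored.graph,
    ∀ (x y : Γ.V) (h : Γ.toColored.graph.Adj x y),
      Δ.toColored.color (e x) (e y) (e.map_adj_iff.2 h) = Γ.toColored.color x y h

theorem Iso.refl (Γ : FinGraph σ q) : Γ.Iso Γ :=
  ⟨SimpleGraph.Iso.refl, fun _ _ _ => rfl⟩

theorem Iso.symm {Γ Δ : FinGraph σ q} (h : Γ.Iso Δ) : Δ.Iso Γ := by
  obtain ⟨e, he⟩ := h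
  refine ⟨e.symm, fun x y hxy => ?_⟩
  have h1 := he (e.symm x) (e.symm y) (e.symm.map_adj_iff.2 hxy)
  rw [← h1]
  congr 1 <;> simp

theorem Iso.trans {Γ Δ Θ : FinGraph σ q} (h : Γ.Iso Δ) (h' : Δ.Iso Θ) : Γ.Iso Θ := by
  obtain ⟨e, he⟩ := h
  obtain ⟨f, hf⟩ := h'
  refine ⟨e.trans f, fun x y hxy => ?_⟩
  exact (hf (e x) (e y) (e.map_adj_iff.2 hxy)).trans (he x y hxy)

instance setoid {G : Type u} (σ : G → G) (q : ℕ) : Setoid (FinGraph σ q) where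
  r := Iso
  iseqv := ⟨Iso.refl, Iso.symm, Iso.trans⟩

/-- The full subgraph on a set of vertices. -/
def restrict (Γ : FinGraph σ q) (s : Set Γ.V) : FinGraph σ q where
  V := s
  fin := inferInstance
  toColored :=
    { graph := Γ.toColored.graph.induce s
      color := fun x y h => Γ.toColored.color x.1 y.1 h
      color_symm := fun x y h => Γ.toColored.color_symm x.1 y.1 h }
  valency_le := fun x => by
    refine le_trans ?_ (Γ.valency_le x.1)
    refine Set.ncard_le_ncard_of_injOn Subtype.val (fun y hy => ?_)
      Subtype.val_injective.injOn (Set.toFinite _)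
    exact hy

/-- The disjoint union of two graphs. -/
def disjointUnion (Γ Δ : FinGraph σ q) : FinGraph σ q where
  V := Γ.V ⊕ Δ.V
  fin := inferInstance
  toColored :=
    { graph := Γ.toColored.graph.sum Δ.toColored.graph
      color := fun x y => match x, y with
        | Sum.inl x, Sum.inl y => fun h => Γ.toColored.color x y h
        | Sum.inr x, Sum.inr y => fun h => Δ.toColored.color x y h
        | Sum.inl _, Sum.inr _ => fun h => False.elim (by simp [SimpleGraph.sum] at h)
        | Sum.inr _, Sum.inl _ => fun h => False.elim (by simp [SimpleGraph.sum] at h)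
      color_symm := fun x y => match x, y with
        | Sum.inl x, Sum.inl y => fun h => Γ.toColored.color_symm x y h
        | Sum.inr x, Sum.inr y => fun h => Δ.toColored.color_symm x y h
        | Sum.inl _, Sum.inr _ => fun h => False.elim (by simp [SimpleGraph.sum] at h)
        | Sum.inr _, Sum.inl _ => fun h => False.elim (by simp [SimpleGraph.sum] at h) }
  valency_le := fun x => by
    rcases x with x | x
    · have h : (Γ.toColored.graph.sum Δ.toColored.graph).neighborSet (Sum.inl x)
          = Sum.inl '' Γ.toColored.graph.neighborSet x := by
        ext (y | y) <;> simp [SimpleGraph.sum, SimpleGraph.neighborSet]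
      rw [h, Set.ncard_image_of_injective _ Sum.inl_injective]
      exact Γ.valency_le x
    · have h : (Γ.toColored.graph.sum Δ.toColored.graph).neighborSet (Sum.inr x)
          = Sum.inr '' Δ.toColored.graph.neighborSet x := by
        ext (y | y) <;> simp [SimpleGraph.sum, SimpleGraph.neighborSet]
      rw [h, Set.ncard_image_of_injective _ Sum.inr_injective]
      exact Δ.valency_le x

/-- The empty graph. -/
def empty {G : Type u} (σ : G → G) (q : ℕ) : FinGraph σ q where
  V := Empty
  fin := inferInstance
  toColored :=
    { graph := ⊥
      color := fun x => x.elim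
      color_symm := fun x => x.elim }
  valency_le := fun x => x.elim

end FinGraph

/-- Configurations: isomorphism classes of finite `(G, σ)`-colored graphs of valency at most `q`. -/
def Conf {G : Type u} (σ : G → G) (q : ℕ) : Type (max 1 u) := Quotient (FinGraph.setoid σ q)

namespace Conf

variable {G : Type u} {σ : G → G} {q : ℕ}

/-- The isomorphism class of a graph. -/
def mk (Γ : FinGraph σ q) : Conf σ q := Quotient.mk _ Γ

/-- A graph representing a configuration. -/
noncomputable def rep (S : Conf σ q) : FinGraph σ q := Quotient.out S

theorem mk_rep (S : Conf σ q) : mk S.rep = S := Quotient.out_eq S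

theorem mk_eq_mk {Γ Δ : FinGraph σ q} : mk Γ = mk Δ ↔ Γ.Iso Δ := Quotient.eq (r := FinGraph.setoid σ q)

/-- The class of the empty graph, the unit of the monoid of configurations. -/
instance : One (Conf σ q) := ⟨mk (FinGraph.empty σ q)⟩

/-- The product of configurations is the class of the disjoint union. -/
noncomputable instance : Mul (Conf σ q) := ⟨fun S T => mk (S.rep.disjointUnion T.rep)⟩

/-- The number of vertices. -/
noncomputable def card (S : Conf σ q) : ℕ := Nat.card S.rep.V

theorem card_mk (Γ : FinGraph σ q) : (mk Γ).card = Nat.card Γ.V := by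
  obtain ⟨e, -⟩ := mk_eq_mk.1 (mk_rep (mk Γ))
  exact Nat.card_congr e.toEquiv

theorem card_mul (S T : Conf σ q) : (S * T).card = S.card + T.card :=
  (card_mk _).trans Nat.card_sum

/-- Connected configurations (the empty one is not connected). -/
def IsConnected (S : Conf σ q) : Prop := S.rep.toColored.graph.Connected

theorem finite_card_le [Finite G] (n : ℕ) : {S : Conf σ q | S.card ≤ n}.Finite := by
  classical
  let D := Σ k : Fin (n + 1), (SimpleGraph (Fin k) × (Fin k → Fin k → Option G))
  let code : FinGraph σ q → D → Prop := fun Γ d =>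
    ∃ e : Γ.V ≃ Fin d.1, (∀ x y, Γ.Adj x y ↔ d.2.1.Adj (e x) (e y)) ∧
      ∀ x y (h : Γ.toColored.graph.Adj x y), d.2.2 (e x) (e y) = some (Γ.toColored.color x y h)
  have hex : ∀ S : {S : Conf σ q | S.card ≤ n}, ∃ d : D, code S.1.rep d := by
    rintro ⟨S, hS⟩
    have hS' : Nat.card S.rep.V ≤ n := hS
    let e : S.rep.V ≃ Fin (Nat.card S.rep.V) := Finite.equivFin _
    refine ⟨⟨⟨Nat.card S.rep.V, by omega⟩,
      S.rep.toColored.graph.comap e.symm,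
      fun i j => if h : S.rep.toColored.graph.Adj (e.symm i) (e.symm j)
        then some (S.rep.toColored.color _ _ h) else none⟩, e, ?_, ?_⟩
    · intro x y
      simp [FinGraph.Adj]
    · intro x y h
      have h' : S.rep.toColored.graph.Adj (e.symm (e x)) (e.symm (e y)) := by simpa using h
      simp only
      rw [dif_pos h']
      congr 1
      congr 1 <;> simp
  choose f hf using hex
  have hinj : Function.Injective f := by
    rintro S T hST
    have h1 := hf S
    have h2 := hf T
    rw [← hST] at h2
    obtain ⟨e, he, hc⟩ := h1
    obtain ⟨e', he', hc'⟩ := h2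
    have key : ∀ x y, T.1.rep.toColored.graph.Adj ((e.trans e'.symm) x) ((e.trans e'.symm) y) ↔
        S.1.rep.toColored.graph.Adj x y := by
      intro x y
      have a := he x y
      have b := he' ((e.trans e'.symm) x) ((e.trans e'.symm) y)
      simp only [Equiv.trans_apply, Equiv.apply_symm_apply] at b
      exact b.trans a.symm
    have hiso : S.1.rep.Iso T.1.rep := by
      refine ⟨⟨e.trans e'.symm, fun {x y} => key x y⟩, fun x y h => ?_⟩
      have a := hc x y h
      have b := hc' ((e.trans e'.symm) x) ((e.trans e'.symm) y) ((key x y).2 h)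
      simp only [Equiv.trans_apply, Equiv.apply_symm_apply] at b
      exact Option.some.inj (b.symm.trans a)
    apply Subtype.ext
    rw [← mk_rep S.1, ← mk_rep T.1]
    exact mk_eq_mk.2 hiso
  exact Finite.of_injective f hinj

theorem finite_mul_eq [Finite G] (S : Conf σ q) :
    {p : Conf σ q × Conf σ q | p.1 * p.2 = S}.Finite := by
  refine ((finite_card_le S.card).prod (finite_card_le S.card)).subset ?_
  rintro ⟨a, b⟩ h
  have h' : a * b = S := h
  have := card_mul a b
  rw [h'] at this
  exact ⟨by show a.card ≤ S.card; omega, by show b.card ≤ S.card; omega⟩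

/-- The covering coefficient: the number of `m`-tuples of full subgraphs of (a representative of)
`U`, of isomorphism types `S 0, …, S (m - 1)`, whose vertices cover all vertices of `U`. -/
noncomputable def covering (U : Conf σ q) {m : ℕ} (S : Fin m → Conf σ q) : ℕ :=
  Nat.card {s : Fin m → Set U.rep.V //
    (∀ i, mk (U.rep.restrict (s i)) = S i) ∧ (⋃ i, s i) = Set.univ}

/-- The growth coefficient `A(S, T)`: the number of full subgraphs of `T` of isomorphism type `S`. -/
noncomputable def growthCoeff (S T : Conf σ q) : ℕ :=
  Nat.card {s : Set T.rep.V // mk (T.rep.restrict s) = S}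

/-- The kabi coefficient `K(S, U)`: the number of full subgraphs of `U`, of isomorphism type `S`,
such that every other vertex of `U` is adjacent to a vertex of the subgraph. -/
noncomputable def kabiCoeff (S U : Conf σ q) : ℕ :=
  Nat.card {s : Set U.rep.V //
    mk (U.rep.restrict s) = S ∧ ∀ x, x ∉ s → ∃ y ∈ s, U.rep.Adj x y}

theorem card_le_of_covering_ne_zero (U : Conf σ q) {m : ℕ} (S : Fin m → Conf σ q)
    (h : U.covering S ≠ 0) : U.card ≤ ∑ i, (S i).card := by
  classical
  obtain ⟨⟨s, hs, hcov⟩⟩ := (Nat.card_ne_zero.1 h).1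
  have : ∀ i, (S i).card = (s i).ncard := fun i => by rw [← hs i, card_mk]; rfl
  simp only [this]
  calc U.card = (Set.univ : Set U.rep.V).ncard := (Set.ncard_univ _).symm
    _ = (⋃ i, s i).ncard := by rw [hcov]
    _ ≤ ∑ i, (s i).ncard := Set.ncard_iUnion_le_of_fintype s

theorem card_le_of_kabiCoeff_ne_zero (S U : Conf σ q) (h : kabiCoeff S U ≠ 0) :
    U.card ≤ S.card + S.card * q := by
  classical
  obtain ⟨⟨s, hs, hk⟩⟩ := (Nat.card_ne_zero.1 h).1
  have hc : S.card = s.ncard := by rw [← hs, card_mk]; rfl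
  have : Fintype s := Fintype.ofFinite _
  have hN : (⋃ y : s, U.rep.toColored.graph.neighborSet y.1).ncard ≤ s.ncard * q := by
    refine (Set.ncard_iUnion_le_of_fintype _).trans ?_
    refine (Finset.sum_le_card_nsmul _ _ q fun y _ => U.rep.valency_le y.1).trans ?_
    rw [Finset.card_univ, ← Nat.card_eq_fintype_card, Nat.card_coe_set_eq, smul_eq_mul]
  have hU : (Set.univ : Set U.rep.V) ⊆ s ∪ ⋃ y : s, U.rep.toColored.graph.neighborSet y.1 := by
    intro x _
    by_cases hx : x ∈ s
    · exact Or.inl hx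
    · obtain ⟨y, hy, hxy⟩ := hk x hx
      exact Or.inr (Set.mem_iUnion.2 ⟨⟨y, hy⟩, SimpleGraph.Adj.symm hxy⟩)
  calc U.card = (Set.univ : Set U.rep.V).ncard := (Set.ncard_univ _).symm
    _ ≤ _ := Set.ncard_le_ncard hU (Set.toFinite _)
    _ ≤ _ := Set.ncard_union_le _ _
    _ ≤ S.card + S.card * q := by rw [hc]; omega

end Conf

/-- The connected configurations. -/
abbrev Conf₀ {G : Type u} (σ : G → G) (q : ℕ) : Type (max 1 u) := {S : Conf σ q // S.IsConnected}

/-- The underlying space of the configuration algebra over `ℝ`: the formal series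
`∑ S, f S • S` over all configurations, given by their coefficients. Its ring multiplication is
`ConfAlg.mul` (not the pointwise one). -/
abbrev ConfAlg {G : Type u} (σ : G → G) (q : ℕ) : Type (max 1 u) := Conf σ q → ℝ

namespace ConfAlg

variable {G : Type u} [Finite G] {σ : G → G} {q : ℕ}

/-- The product of the configuration algebra. -/
noncomputable def mul (f g : ConfAlg σ q) : ConfAlg σ q := fun S =>
  ∑ p ∈ (Conf.finite_mul_eq S).toFinset, f p.1 * g p.2

open Classical in
/-- The unit of the configuration algebra. -/
noncomputable def one : ConfAlg σ q := fun S => if S = 1 then 1 else 0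

/-- Powers in the configuration algebra. -/
noncomputable def pow (f : ConfAlg σ q) : ℕ → ConfAlg σ q
  | 0 => one
  | n + 1 => mul (pow f n) f

/-- The logarithm `log (1 + f) = ∑ n ≥ 1, (-1) ^ (n - 1) / n • f ^ n` of a series `a = 1 + f` with
constant term `1`. As `f` has no constant term, `f ^ n` has no term of degree less than `n`, so
that only the terms with `1 ≤ n ≤ S.card` contribute to the coefficient at `S`. -/
noncomputable def log (a : ConfAlg σ q) : ConfAlg σ q := fun S =>
  ∑ n ∈ Finset.range S.card, (-1 : ℝ) ^ n / ((n : ℝ) + 1) * pow (a - one) (n + 1) S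

/-- The growth function `𝒜(T) = ∑ S, A(S, T) • S`, the sum of all full subgraphs of `T`. -/
noncomputable def growth (T : Conf σ q) : ConfAlg σ q := fun S => (Conf.growthCoeff S T : ℝ)

/-- The logarithmic growth function `ℳ(T) = log 𝒜(T)`. -/
noncomputable def logGrowth (T : Conf σ q) : ConfAlg σ q := log (growth T)

/-- The coproduct `Φ_m`, with values in the completed `m`-fold tensor power of the configuration
algebra, i.e. in the formal series in the `S 0 ⊗ ⋯ ⊗ S (m - 1)`. The sum is finite. -/
noncomputable def coproduct (m : ℕ) (f : ConfAlg σ q) : (Fin m → Conf σ q) → ℝ := fun S =>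
  ∑ᶠ U : Conf σ q, (U.covering S : ℝ) * f U

open Classical in
/-- The element `1 ⊗ ⋯ ⊗ 1 ⊗ f ⊗ 1 ⊗ ⋯ ⊗ 1` with `f` at the `i`-th place. -/
noncomputable def slot {m : ℕ} (i : Fin m) (f : ConfAlg σ q) : (Fin m → Conf σ q) → ℝ := fun S =>
  if ∀ j, j ≠ i → S j = 1 then f (S i) else 0

/-- Lie-like (primitive) elements. -/
def IsLieLike (f : ConfAlg σ q) : Prop :=
  ∀ m : ℕ, coproduct m f = ∑ i : Fin m, slot i f

theorem finite_support_coproduct (m : ℕ) (f : ConfAlg σ q) (S : Fin m → Conf σ q) :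
    (Function.support fun U : Conf σ q => (U.covering S : ℝ) * f U).Finite := by
  refine (Conf.finite_card_le (∑ i, (S i).card)).subset fun U hU => ?_
  refine Conf.card_le_of_covering_ne_zero U S ?_
  intro h
  exact hU (by simp [h])

/-- The vector space of Lie-like elements. -/
def lieLike {G : Type u} [Finite G] (σ : G → G) (q : ℕ) : Submodule ℝ (ConfAlg σ q) where
  carrier := {f | IsLieLike f}
  add_mem' := fun {f g} hf hg m => by
    have h1 : coproduct m (f + g) = coproduct m f + coproduct m g := by
      funext S
      simp only [coproduct, Pi.add_apply, mul_add]
      exact finsum_add_distrib (finite_support_coproduct m f S) (finite_support_coproduct m g S)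
    have h2 : ∀ i : Fin m, slot i (f + g) = slot i f + slot i g := fun i => by
      funext S
      simp only [slot, Pi.add_apply]
      split_ifs <;> simp
    rw [h1, hf m, hg m, ← Finset.sum_add_distrib]
    exact Finset.sum_congr rfl fun i _ => (h2 i).symm
  zero_mem' := fun m => by
    funext S
    simp [coproduct, slot, Finset.sum_apply]
  smul_mem' := fun c f hf m => by
    have h1 : coproduct m (c • f) = c • coproduct m f := by
      funext S
      simp only [coproduct, Pi.smul_apply, smul_eq_mul]
      rw [mul_finsum]
      exact finsum_congr fun U => by ring
    have h2 : ∀ i : Fin m, slot i (c • f) = c • slot i f := fun i => by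
      funext S
      simp only [slot, Pi.smul_apply]
      split_ifs <;> simp
    rw [h1, hf m, Finset.smul_sum]
    exact Finset.sum_congr rfl fun i _ => (h2 i).symm

end ConfAlg

/-- The space `ℒ_ℝ` of Lie-like elements, to be equipped with the classical topology. -/
def LieSpace {G : Type u} [Finite G] (σ : G → G) (q : ℕ) : Type (max 1 u) :=
  ↥(ConfAlg.lieLike σ q)

namespace LieSpace

variable {G : Type u} [Finite G] {σ : G → G} {q : ℕ}

noncomputable instance : AddCommGroup (LieSpace σ q) :=
  inferInstanceAs (AddCommGroup ↥(ConfAlg.lieLike σ q))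

noncomputable instance : Module ℝ (LieSpace σ q) :=
  inferInstanceAs (Module ℝ ↥(ConfAlg.lieLike σ q))

/-- A Lie-like element as an element of the configuration algebra. -/
noncomputable def toConfAlg : LieSpace σ q →ₗ[ℝ] ConfAlg σ q := (ConfAlg.lieLike σ q).subtype

/-- The Lie-like elements all of whose terms have degree at least `n`. -/
noncomputable def degreeGE {G : Type u} [Finite G] (σ : G → G) (q n : ℕ) : Submodule ℝ (LieSpace σ q) where
  carrier := {x | ∀ S : Conf σ q, S.card < n → x.toConfAlg S = 0}
  add_mem' := fun {x y} hx hy S hS => by simp [hx S hS, hy S hS]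
  zero_mem' := fun S _ => by simp
  smul_mem' := fun c x hx S hS => by simp [hx S hS]

/-- The classical topology on `ℒ_ℝ`: the projective limit topology for the projections of `ℒ_ℝ` to
its finite dimensional quotients by the subspaces of elements of degree at least `n`, each of these
quotients carrying its usual topology as a finite dimensional real vector space. -/
noncomputable instance : TopologicalSpace (LieSpace σ q) :=
  ⨅ n : ℕ, TopologicalSpace.induced (degreeGE σ q n).mkQ
    (moduleTopology ℝ (LieSpace σ q ⧸ degreeGE σ q n))

theorem finite_support_kabi (x : LieSpace σ q) (T : Conf₀ σ q) :
    (Function.support fun S : Conf₀ σ q => (-1 : ℝ) ^ (T.1.card + S.1.card) *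
      (Conf.kabiCoeff T.1 S.1 : ℝ) * x.toConfAlg S.1).Finite := by
  have h := (Conf.finite_card_le (σ := σ) (q := q) (T.1.card + T.1.card * q)).preimage
    (f := fun S : Conf₀ σ q => S.1) Subtype.val_injective.injOn
  refine h.subset fun S hS => ?_
  refine Conf.card_le_of_kabiCoeff_ne_zero T.1 S.1 ?_
  intro h0
  exact hS (by simp [h0])

/-- The kabi map from `ℒ_ℝ` to the formal (infinite) combinations of the symbols `ℳ(T)`, `T`
connected. It sends `∑ S, a S • φ(S)` to the combination with the coefficient
`∑ S, (-1) ^ (#T - #S) * K(T, S) * a S` at `ℳ(T)`, where the sums are over connected `S`. Here `φ` is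
the topological basis of `ℒ_ℝ` dual to the coefficients at the connected configurations, so that
`a S` is the coefficient of the given element at `S`. The sum is finite. -/
noncomputable def kabi {G : Type u} [Finite G] (σ : G → G) (q : ℕ) :
    LieSpace σ q →ₗ[ℝ] (Conf₀ σ q → ℝ) where
  toFun := fun x T => ∑ᶠ S : Conf₀ σ q, (-1 : ℝ) ^ (T.1.card + S.1.card) *
    (Conf.kabiCoeff T.1 S.1 : ℝ) * x.toConfAlg S.1
  map_add' := fun x y => by
    funext T
    simp only [map_add, Pi.add_apply, mul_add]
    exact finsum_add_distrib (finite_support_kabi x T) (finite_support_kabi y T)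
  map_smul' := fun c x => by
    funext T
    simp only [map_smul, Pi.smul_apply, smul_eq_mul, RingHom.id_apply]
    rw [mul_finsum]
    exact finsum_congr fun S => by ring

/-- The space `ℒ_{ℝ,∞}` of Lie-like elements at infinity. -/
noncomputable def atInfinity {G : Type u} [Finite G] (σ : G → G) (q : ℕ) :
    Submodule ℝ (LieSpace σ q) :=
  LinearMap.ker (kabi σ q)

/-- `IsAbsSum a x`: the formal sum `∑ T, a T • ℳ(T)` over the connected configurations is absolutely
convergent (at every coefficient), and its sum is the Lie-like element `x`. -/
def IsAbsSum (a : Conf₀ σ q → ℝ) (x : LieSpace σ q) : Prop :=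
  ∀ S : Conf σ q,
    (Summable fun T : Conf₀ σ q => |a T * ConfAlg.logGrowth T.1 S|) ∧
    HasSum (fun T : Conf₀ σ q => a T * ConfAlg.logGrowth T.1 S) (x.toConfAlg S)

/-- The space `ℒ_{ℝ,abs}` of absolutely convergent sums of the `ℳ(T)`, `T` connected. -/
noncomputable def absConv {G : Type u} [Finite G] (σ : G → G) (q : ℕ) :
    Submodule ℝ (LieSpace σ q) where
  carrier := {x | ∃ a : Conf₀ σ q → ℝ, IsAbsSum a x}
  add_mem' := by
    rintro x y ⟨a, ha⟩ ⟨b, hb⟩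
    refine ⟨a + b, fun S => ?_⟩
    have h : HasSum (fun T : Conf₀ σ q => (a + b) T * ConfAlg.logGrowth T.1 S)
        ((x + y).toConfAlg S) := by
      simpa [add_mul] using (ha S).2.add (hb S).2
    exact ⟨h.summable.abs, h⟩
  zero_mem' := ⟨0, fun S => by
    have h : HasSum (fun T : Conf₀ σ q => (0 : Conf₀ σ q → ℝ) T * ConfAlg.logGrowth T.1 S)
        ((0 : LieSpace σ q).toConfAlg S) := by
      simp
    exact ⟨h.summable.abs, h⟩⟩
  smul_mem' := by
    rintro c x ⟨a, ha⟩
    refine ⟨c • a, fun S => ?_⟩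
    have h : HasSum (fun T : Conf₀ σ q => (c • a) T * ConfAlg.logGrowth T.1 S)
        ((c • x).toConfAlg S) := by
      simpa [mul_assoc] using (ha S).2.mul_left c
    exact ⟨h.summable.abs, h⟩

/-- The set of the free energies `ℳ(T) / #T` for all nonempty configurations `T`, in `ℒ_ℝ`. -/
def logEDP {G : Type u} [Finite G] (σ : G → G) (q : ℕ) : Set (LieSpace σ q) :=
  {x | ∃ T : Conf σ q, T ≠ 1 ∧ x.toConfAlg = (1 / (T.card : ℝ)) • ConfAlg.logGrowth T}

/-- The closure `Ω` of the set of free energies in the classical topology. -/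
def Omega {G : Type u} [Finite G] (σ : G → G) (q : ℕ) : Set (LieSpace σ q) :=
  closure (logEDP σ q)

/-- The finite (absolutely convergent) part of `Ω`. -/
def OmegaAbs {G : Type u} [Finite G] (σ : G → G) (q : ℕ) : Set (LieSpace σ q) :=
  Omega σ q ∩ absConv σ q

/-- The infinite part of `Ω`. -/
def OmegaInf {G : Type u} [Finite G] (σ : G → G) (q : ℕ) : Set (LieSpace σ q) :=
  Omega σ q ∩ atInfinity σ q

end LieSpace

/-- The join of two subsets of a real vector space: the union of all segments from a point of `A` to
a point of `B`, with the usual convention that the join with the empty set is the other set. The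
terms `A` and `B` of the union matter only if one of the two sets is empty,
see `join_eq_of_nonempty`. -/
def join {E : Type*} [AddCommGroup E] [Module ℝ E] (A B : Set E) : Set E :=
  A ∪ B ∪ {x | ∃ p ∈ A, ∃ r ∈ B, ∃ t ∈ Set.Icc (0 : ℝ) 1, x = t • p + (1 - t) • r}

theorem join_eq_of_nonempty {E : Type*} [AddCommGroup E] [Module ℝ E] {A B : Set E}
    (hA : A.Nonempty) (hB : B.Nonempty) :
    join A B = {x | ∃ p ∈ A, ∃ r ∈ B, ∃ t ∈ Set.Icc (0 : ℝ) 1, x = t • p + (1 - t) • r} := by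
  obtain ⟨a, ha⟩ := hA
  obtain ⟨b, hb⟩ := hB
  apply Set.union_eq_self_of_subset_left
  rintro x (hx | hx)
  · exact ⟨x, hx, b, hb, 1, by simp, by simp⟩
  · exact ⟨a, ha, x, hx, 0, by simp, by simp⟩

/-- The infinite simplex of all families of nonnegative weights of total sum `1`. -/
def weights (ι : Type*) : Set (ι → ℝ) := {μ | (∀ i, 0 ≤ μ i) ∧ HasSum μ 1}

/-! Growth functions are multiplicative, `growth (T * T') = growth T · growth T'`, and group-like:
counting tuples of subgraphs by their union gives `∑ U, covering U S · A(U, T) = ∏ i, A(S i, T)`.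
Hence `k ↦ A(S, T ^ k)` is a polynomial, and its derivative at `0` is `M(S, T)`. Differentiating the
group-like identity at `0` shows that `ℳ(T)` is Lie-like. For connected `S` the polynomial is
linear, so `M(S, T) = A(S, T)`.

A Lie-like element is determined by its coefficients at connected configurations (`coeff_mem_span`):
the vanishing of `Φ_2` at `S₁ ⊗ S₂` expresses the coefficient at `S₁ * S₂` through simpler ones. It
follows that `ℳ` is additive and, by bounded valency, that `|M(S, T)| ≤ C_S · #T`. Additivity makes
every rational convex combination of free energies a free energy, so `Ω` is convex. The bound puts
`Ω` inside a product of intervals, so it is compact. Cutting into components makes `Ω` the closed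
convex hull of the points `v_S = ℳ(S) / #S` with `S` connected.

Inclusion–exclusion shows that the kabi coordinates are dual to the `ℳ(T)`
(`finsum_kabiCoeff_mul_growthCoeff`). Thus the continuous functionals `#S · kabi_S` are dual to the
`v_S`, and on `Ω` they are nonnegative with sum at most `1`. Splitting off finitely many coordinates
leaves a multiple of another point of `Ω`, and compactness allows all of them to be split off
(`exists_expansion`): `x = p + (1 - c) y` with `p` the expansion of `x`, `c` the sum of its
coordinates and `y ∈ Ω`. If `c < 1`, all kabi coordinates of `y` vanish, which gives the join. The
coefficient at the one-vertex graph is `1` on `Ω`, which forces `c = 1` when `x = p` and gives the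
simplex. -/

/-! ### Embeddings and the transport of counting coefficients -/

/-- An embedding of a colored graph as a full subgraph of another one. -/
structure ColEmb {G : Type u} {σ : G → G} {q : ℕ} (Γ Δ : FinGraph σ q) where
  emb : Γ.toColored.graph ↪g Δ.toColored.graph
  color_eq : ∀ (x y : Γ.V) (h : Γ.toColored.graph.Adj x y),
    Δ.toColored.color (emb x) (emb y) (emb.map_adj_iff.2 h) = Γ.toColored.color x y h

namespace ColEmb

variable {G : Type u} {σ : G → G} {q : ℕ} {Γ Δ Θ : FinGraph σ q}

theorem injective (f : ColEmb Γ Δ) : Function.Injective f.emb := f.emb.injective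

theorem adj_iff (f : ColEmb Γ Δ) {x y : Γ.V} : Δ.Adj (f.emb x) (f.emb y) ↔ Γ.Adj x y :=
  f.emb.map_adj_iff

/-- Composition of embeddings. -/
def comp (g : ColEmb Δ Θ) (f : ColEmb Γ Δ) : ColEmb Γ Θ where
  emb := g.emb.comp f.emb
  color_eq := fun x y h => (g.color_eq _ _ (f.emb.map_adj_iff.2 h)).trans (f.color_eq x y h)

/-- The inclusion of a full subgraph. -/
def ofRestrict (Γ : FinGraph σ q) (s : Set Γ.V) : ColEmb (Γ.restrict s) Γ where
  emb := SimpleGraph.Embedding.induce s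
  color_eq := fun _ _ _ => rfl

theorem range_ofRestrict (Γ : FinGraph σ q) (s : Set Γ.V) :
    Set.range (ofRestrict Γ s).emb = s := Subtype.range_val

theorem iso_restrict_image (f : ColEmb Γ Δ) (s : Set Γ.V) :
    (Γ.restrict s).Iso (Δ.restrict (f.emb '' s)) :=
  ⟨⟨Equiv.Set.image f.emb s f.injective, fun {x y} => f.emb.map_adj_iff (v := x.1) (w := y.1)⟩,
    fun x y h => f.color_eq x.1 y.1 h⟩

theorem mk_restrict_image (f : ColEmb Γ Δ) (s : Set Γ.V) :
    Conf.mk (Δ.restrict (f.emb '' s)) = Conf.mk (Γ.restrict s) :=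
  (Conf.mk_eq_mk.2 (f.iso_restrict_image s)).symm

theorem exists_of_iso (h : Γ.Iso Δ) : ∃ f : ColEmb Γ Δ, Function.Surjective f.emb := by
  obtain ⟨e, he⟩ := h
  exact ⟨⟨e.toEmbedding, he⟩, e.surjective⟩

theorem iso_of_surjective (f : ColEmb Γ Δ) (hf : Function.Surjective f.emb) : Γ.Iso Δ :=
  ⟨⟨Equiv.ofBijective f.emb ⟨f.injective, hf⟩, fun {_ _} => f.emb.map_adj_iff⟩, f.color_eq⟩

theorem exists_rep (Γ : FinGraph σ q) :
    ∃ f : ColEmb (Conf.mk Γ).rep Γ, Function.Surjective f.emb :=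
  exists_of_iso (Conf.mk_eq_mk.1 (Conf.mk_rep (Conf.mk Γ)))

theorem exists_rep_restrict (Γ : FinGraph σ q) (s : Set Γ.V) :
    ∃ f : ColEmb (Conf.mk (Γ.restrict s)).rep Γ, Set.range f.emb = s := by
  obtain ⟨f, hf⟩ := exists_rep (Γ.restrict s)
  refine ⟨(ofRestrict Γ s).comp f, ?_⟩
  have : ⇑((ofRestrict Γ s).comp f).emb = (ofRestrict Γ s).emb ∘ f.emb := rfl
  rw [this, hf.range_comp, range_ofRestrict]

/-- Full subgraphs of `Γ` correspond to full subgraphs of `Δ` contained in the image of `Γ`. -/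
theorem card_sets (f : ColEmb Γ Δ) (P : Set Γ.V → Prop) (Q : Set Δ.V → Prop)
    (h : ∀ s, P s ↔ Q (f.emb '' s)) :
    Nat.card {s // P s} = Nat.card {s // s ⊆ Set.range f.emb ∧ Q s} := by
  refine Nat.card_congr ⟨fun s => ⟨f.emb '' s.1, Set.image_subset_range _ _, (h _).1 s.2⟩,
    fun t => ⟨f.emb ⁻¹' t.1, (h _).2 ?_⟩, fun s => ?_, fun t => ?_⟩
  · rw [Set.image_preimage_eq_of_subset t.2.1]; exact t.2.2
  · exact Subtype.ext (Set.preimage_image_eq _ f.injective)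
  · exact Subtype.ext (Set.image_preimage_eq_of_subset t.2.1)

end ColEmb

namespace Conf

variable {G : Type u} {σ : G → G} {q : ℕ}

/-- The coefficients are defined on a chosen representative. This lemma and the next two move the
count into an ambient graph, so that subgraphs of subgraphs are counted on a single vertex set. -/
theorem growthCoeff_of_emb {T : Conf σ q} {Δ : FinGraph σ q} (f : ColEmb T.rep Δ)
    (S : Conf σ q) :
    growthCoeff S T = Nat.card {s : Set Δ.V // s ⊆ Set.range f.emb ∧ mk (Δ.restrict s) = S} :=
  f.card_sets _ _ fun s => by rw [f.mk_restrict_image]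

theorem kabiCoeff_of_emb {T : Conf σ q} {Δ : FinGraph σ q} (f : ColEmb T.rep Δ)
    (S : Conf σ q) :
    kabiCoeff S T = Nat.card {s : Set Δ.V // s ⊆ Set.range f.emb ∧ mk (Δ.restrict s) = S ∧
      ∀ x ∈ Set.range f.emb, x ∉ s → ∃ y ∈ s, Δ.Adj x y} :=
  f.card_sets _ _ fun s => by
    rw [f.mk_restrict_image]
    simp only [Set.forall_mem_range, Set.exists_mem_image, f.injective.mem_set_image, f.adj_iff]

theorem covering_of_emb {T : Conf σ q} {Δ : FinGraph σ q} (f : ColEmb T.rep Δ)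
    {m : ℕ} (S : Fin m → Conf σ q) :
    covering T S = Nat.card {s : Fin m → Set Δ.V //
      (∀ i, mk (Δ.restrict (s i)) = S i) ∧ (⋃ i, s i) = Set.range f.emb} := by
  refine Nat.card_congr ⟨fun s => ⟨fun i => f.emb '' s.1 i, fun i => ?_, ?_⟩,
    fun t => ⟨fun i => f.emb ⁻¹' t.1 i, fun i => ?_, ?_⟩, fun s => ?_, fun t => ?_⟩
  · rw [f.mk_restrict_image]; exact s.2.1 i
  · rw [← Set.image_iUnion, s.2.2, Set.image_univ]
  · rw [← f.mk_restrict_image, Set.image_preimage_eq_of_subset]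
    · exact t.2.1 i
    · exact (Set.subset_iUnion t.1 i).trans t.2.2.subset
  · rw [← Set.preimage_iUnion, t.2.2, Set.preimage_range]
  · exact Subtype.ext (funext fun i => Set.preimage_image_eq _ f.injective)
  · refine Subtype.ext (funext fun i => Set.image_preimage_eq_of_subset ?_)
    exact (Set.subset_iUnion t.1 i).trans t.2.2.subset

/-- Frees products from the representatives chosen in `Mul`: it suffices to see the two factors as
separated parts of some graph. -/
theorem mul_eq_mk {Γ Δ Θ : FinGraph σ q} (f : ColEmb Γ Θ) (g : ColEmb Δ Θ)
    (hcov : ∀ z, z ∈ Set.range f.emb ∨ z ∈ Set.range g.emb)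
    (hne : ∀ x y, f.emb x ≠ g.emb y) (hadj : ∀ x y, ¬ Θ.Adj (f.emb x) (g.emb y)) :
    mk Γ * mk Δ = mk Θ := by
  obtain ⟨f', hf'⟩ := ColEmb.exists_rep Γ
  obtain ⟨g', hg'⟩ := ColEmb.exists_rep Δ
  let a := f.comp f'
  let b := g.comp g'
  have hadj' : ∀ x y, ¬ Θ.toColored.graph.Adj (a.emb x) (b.emb y) := fun x y => hadj _ _
  have hinj : Function.Injective (Sum.elim a.emb b.emb) :=
    a.injective.sumElim b.injective fun x y => hne _ _
  let c : ColEmb ((mk Γ).rep.disjointUnion (mk Δ).rep) Θ :=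
    { emb := ⟨⟨Sum.elim a.emb b.emb, hinj⟩, fun {x y} => by
        rcases x with x | x <;> rcases y with y | y
        · exact a.emb.map_adj_iff
        · exact iff_of_false (hadj' x y) (by simp [FinGraph.disjointUnion])
        · exact iff_of_false (fun h => hadj' y x h.symm) (by simp [FinGraph.disjointUnion])
        · exact b.emb.map_adj_iff⟩
      color_eq := fun x y h => by
        rcases x with x | x <;> rcases y with y | y
        · exact a.color_eq x y h
        · exact absurd h (by simp [FinGraph.disjointUnion])
        · exact absurd h (by simp [FinGraph.disjointUnion])
        · exact b.color_eq x y h }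
  refine mk_eq_mk.2 (c.iso_of_surjective fun z => ?_)
  rcases hcov z with ⟨x, rfl⟩ | ⟨x, rfl⟩
  · obtain ⟨x, rfl⟩ := hf' x; exact ⟨Sum.inl x, rfl⟩
  · obtain ⟨x, rfl⟩ := hg' x; exact ⟨Sum.inr x, rfl⟩

/-! ### Unit, products and connectedness of configurations -/

theorem mk_eq_one {Γ : FinGraph σ q} [IsEmpty Γ.V] : mk Γ = 1 := by
  refine mk_eq_mk.2 ⟨⟨Equiv.equivOfIsEmpty _ Empty, fun {x} => isEmptyElim x⟩,
    fun x => isEmptyElim x⟩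

theorem card_one : (1 : Conf σ q).card = 0 := (card_mk _).trans (Nat.card_eq_zero.2 (Or.inl
  (inferInstanceAs (IsEmpty Empty))))

theorem card_eq_zero_iff {S : Conf σ q} : S.card = 0 ↔ S = 1 := by
  refine ⟨fun h => ?_, fun h => h ▸ card_one⟩
  rw [← mk_rep S]
  rcases Nat.card_eq_zero.1 h with h | h
  · exact mk_eq_one
  · exact absurd h (not_infinite_iff_finite.2 inferInstance)

theorem card_pos {S : Conf σ q} (h : S ≠ 1) : 0 < S.card :=
  Nat.pos_of_ne_zero fun h' => h (card_eq_zero_iff.1 h')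

theorem mk_restrict_univ (Γ : FinGraph σ q) : mk (Γ.restrict Set.univ) = mk Γ :=
  mk_eq_mk.2 ((ColEmb.ofRestrict Γ Set.univ).iso_of_surjective fun x => ⟨⟨x, trivial⟩, rfl⟩)

theorem card_mk_restrict (Γ : FinGraph σ q) (s : Set Γ.V) : (mk (Γ.restrict s)).card = s.ncard :=
  card_mk _

theorem mk_restrict_empty (Γ : FinGraph σ q) : mk (Γ.restrict ∅) = 1 :=
  card_eq_zero_iff.1 (by rw [card_mk_restrict, Set.ncard_empty])

theorem mk_restrict_eq_one {Γ : FinGraph σ q} {s : Set Γ.V} : mk (Γ.restrict s) = 1 ↔ s = ∅ := by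
  rw [← card_eq_zero_iff, card_mk_restrict, Set.ncard_eq_zero]

/-- A graph is the product of two complementary parts which are not joined by an edge. -/
theorem mk_restrict_mul_restrict {Γ : FinGraph σ q} {s t u : Set Γ.V} (hu : s ∪ t = u)
    (hd : Disjoint s t) (hadj : ∀ x ∈ s, ∀ y ∈ t, ¬ Γ.Adj x y) :
    mk (Γ.restrict s) * mk (Γ.restrict t) = mk (Γ.restrict u) := by
  subst hu
  have key : ∀ (w u : Set Γ.V) (h : w ⊆ u),
      ∃ f : ColEmb (Γ.restrict w) (Γ.restrict u), ∀ x, (f.emb x).1 = x.1 := fun w u h =>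
    ⟨⟨⟨Set.embeddingOfSubset _ _ h, Iff.rfl⟩, fun _ _ _ => rfl⟩, fun _ => rfl⟩
  obtain ⟨f, hf⟩ := key s (s ∪ t) Set.subset_union_left
  obtain ⟨g, hg⟩ := key t (s ∪ t) Set.subset_union_right
  refine mul_eq_mk f g ?_ ?_ ?_
  · rintro ⟨z, hz | hz⟩
    · exact Or.inl ⟨⟨z, hz⟩, Subtype.ext (hf _)⟩
    · exact Or.inr ⟨⟨z, hz⟩, Subtype.ext (hg _)⟩
  · intro x y h
    have h1 : x.1 = y.1 := by rw [← hf x, ← hg y, h]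
    exact Set.disjoint_left.1 hd x.2 (h1 ▸ y.2)
  · intro x y h
    refine hadj x.1 x.2 y.1 y.2 ?_
    rw [← hf x, ← hg y]
    exact h

theorem mul_one' (S : Conf σ q) : S * 1 = S := by
  have h := mk_restrict_mul_restrict (Γ := S.rep) (Set.union_empty Set.univ)
    (Set.disjoint_empty _) (by simp)
  rwa [mk_restrict_empty, mk_restrict_univ, mk_rep] at h

theorem one_mul' (S : Conf σ q) : 1 * S = S := by
  have h := mk_restrict_mul_restrict (Γ := S.rep) (Set.empty_union Set.univ)
    (Set.empty_disjoint _) (by simp)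
  rwa [mk_restrict_empty, mk_restrict_univ, mk_rep] at h

/-- The inclusion of the first summand. -/
def _root_.ColEmb.inl (Γ Δ : FinGraph σ q) : ColEmb Γ (Γ.disjointUnion Δ) where
  emb := ⟨⟨Sum.inl, Sum.inl_injective⟩, Iff.rfl⟩
  color_eq := fun _ _ _ => rfl

/-- The inclusion of the second summand. -/
def _root_.ColEmb.inr (Γ Δ : FinGraph σ q) : ColEmb Δ (Γ.disjointUnion Δ) where
  emb := ⟨⟨Sum.inr, Sum.inr_injective⟩, Iff.rfl⟩
  color_eq := fun _ _ _ => rfl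

theorem mk_restrict_disjointUnion (Γ Δ : FinGraph σ q) (w : Set (Γ.disjointUnion Δ).V) :
    mk ((Γ.disjointUnion Δ).restrict w) =
      mk (Γ.restrict (Sum.inl ⁻¹' w)) * mk (Δ.restrict (Sum.inr ⁻¹' w)) := by
  rw [← (ColEmb.inl Γ Δ).mk_restrict_image, ← (ColEmb.inr Γ Δ).mk_restrict_image]
  symm
  refine mk_restrict_mul_restrict ?_ ?_ ?_
  · ext (x | x)
    · exact ⟨fun h => h.elim (fun ⟨y, hy, e⟩ => e ▸ hy) (fun ⟨y, hy, e⟩ => e ▸ hy),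
        fun h => Or.inl ⟨x, h, rfl⟩⟩
    · exact ⟨fun h => h.elim (fun ⟨y, hy, e⟩ => e ▸ hy) (fun ⟨y, hy, e⟩ => e ▸ hy),
        fun h => Or.inr ⟨x, h, rfl⟩⟩
  · rw [Set.disjoint_left]
    rintro _ ⟨x, -, rfl⟩ ⟨y, -, h⟩
    exact Sum.inr_ne_inl h
  · rintro _ ⟨x, -, rfl⟩ _ ⟨y, -, rfl⟩ h
    change (Γ.toColored.graph.sum Δ.toColored.graph).Adj (Sum.inl x) (Sum.inr y) at h
    simp at h

theorem isConnected_mk {Γ : FinGraph σ q} : (mk Γ).IsConnected ↔ Γ.toColored.graph.Connected := by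
  obtain ⟨e, -⟩ := mk_eq_mk.1 (mk_rep (mk Γ))
  exact e.connected_iff

theorem IsConnected.ne_one {S : Conf σ q} (h : S.IsConnected) : S ≠ 1 := by
  intro h1
  have h2 : 0 < Nat.card S.rep.V := by
    have : Nonempty S.rep.V := SimpleGraph.Connected.nonempty h
    exact Nat.card_pos
  have h3 : S.card = 0 := card_eq_zero_iff.2 h1
  have h4 : S.card = Nat.card S.rep.V := rfl
  omega

/-- A set of vertices of a connected graph that no edge leaves is empty or everything. -/
theorem _root_.SimpleGraph.Preconnected.eq_univ_of_forall_not_adj {V : Type*} {H : SimpleGraph V}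
    (hH : H.Preconnected) {s : Set V} (hs : s.Nonempty)
    (h : ∀ x ∈ s, ∀ y, y ∉ s → ¬ H.Adj x y) : s = Set.univ := by
  obtain ⟨x, hx⟩ := hs
  refine Set.eq_univ_of_forall fun y => ?_
  obtain ⟨w⟩ := hH x y
  induction w with
  | nil => exact hx
  | cons hadj w ih => exact ih (by by_contra hc; exact h _ hx _ hc hadj)

theorem eq_one_or_eq_one_of_isConnected_mul {S T : Conf σ q} (h : (S * T).IsConnected) :
    S = 1 ∨ T = 1 := by
  have hc : (S.rep.toColored.graph.sum T.rep.toColored.graph).Connected :=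
    isConnected_mk (Γ := S.rep.disjointUnion T.rep).1 h
  by_contra! hne
  have hS : Nonempty S.rep.V := (Nat.card_pos_iff.1 (card_pos hne.1)).1
  have hT : Nonempty T.rep.V := (Nat.card_pos_iff.1 (card_pos hne.2)).1
  have := hc.preconnected.eq_univ_of_forall_not_adj (s := Set.range Sum.inl)
    (Set.range_nonempty _) (by
      rintro _ ⟨x, rfl⟩ (y | y) hy
      · exact absurd ⟨y, rfl⟩ hy
      · simp)
  obtain ⟨x, hx⟩ := (this ▸ Set.mem_univ _ : Sum.inr hT.some ∈ Set.range (Sum.inl : S.rep.V → _))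
  exact Sum.inl_ne_inr hx

theorem exists_mul_eq {S : Conf σ q} (h1 : S ≠ 1) (hS : ¬ S.IsConnected) :
    ∃ S₁ S₂ : Conf σ q, S₁ ≠ 1 ∧ S₂ ≠ 1 ∧ S₁ * S₂ = S := by
  have hne : Nonempty S.rep.V := (Nat.card_pos_iff.1 (card_pos h1)).1
  have hS' : ¬ S.rep.toColored.graph.Preconnected := fun h => hS ⟨h⟩
  simp only [SimpleGraph.Preconnected, not_forall] at hS'
  obtain ⟨x, y, hxy⟩ := hS'
  -- The component of `x` is one factor and its complement, which contains `y`, is the other.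
  let s : Set S.rep.V := {z | S.rep.toColored.graph.Reachable x z}
  refine ⟨mk (S.rep.restrict s), mk (S.rep.restrict sᶜ), ?_, ?_, ?_⟩
  · rw [Ne, mk_restrict_eq_one]
    exact Set.Nonempty.ne_empty ⟨x, SimpleGraph.Reachable.refl x⟩
  · rw [Ne, mk_restrict_eq_one]
    exact Set.Nonempty.ne_empty ⟨y, hxy⟩
  · rw [mk_restrict_mul_restrict (Set.union_compl_self s) disjoint_compl_right,
      mk_restrict_univ, mk_rep]
    intro z hz w hw hadj
    exact hw (SimpleGraph.Reachable.trans hz (SimpleGraph.Adj.reachable hadj))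

end Conf

/-! ### Growth coefficients as sums over vertex sets -/

noncomputable instance FinGraph.fintypeV {G : Type u} {σ : G → G} {q : ℕ} (Γ : FinGraph σ q) :
    Fintype Γ.V := Fintype.ofFinite _

namespace Conf

variable {G : Type u} {σ : G → G} {q : ℕ}

theorem growthCoeff_one (T : Conf σ q) : growthCoeff 1 T = 1 := by
  have : Unique {s : Set T.rep.V // mk (T.rep.restrict s) = 1} :=
    ⟨⟨⟨∅, mk_restrict_empty _⟩⟩, fun s => Subtype.ext (mk_restrict_eq_one.1 s.2)⟩
  exact Nat.card_unique

theorem card_le_of_growthCoeff_ne_zero {S T : Conf σ q} (h : growthCoeff S T ≠ 0) :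
    S.card ≤ T.card := by
  obtain ⟨⟨s, hs⟩⟩ := (Nat.card_ne_zero.1 h).1
  rw [← hs, card_mk_restrict]
  exact Set.ncard_le_card s

open Classical in
theorem growthCoeff_eq_sum (S T : Conf σ q) :
    (growthCoeff S T : ℝ) = ∑ s : Set T.rep.V, if mk (T.rep.restrict s) = S then 1 else 0 := by
  rw [growthCoeff, Nat.card_eq_fintype_card, Fintype.card_subtype, Finset.sum_boole]

/-- Summing over the types of full subgraphs amounts to summing over the full subgraphs. -/
theorem finsum_mul_growthCoeff (F : Conf σ q → ℝ) (T : Conf σ q) :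
    ∑ᶠ U : Conf σ q, F U * growthCoeff U T = ∑ s : Set T.rep.V, F (mk (T.rep.restrict s)) := by
  classical
  rw [finsum_eq_sum_of_support_subset (s := Finset.univ.image fun s => mk (T.rep.restrict s))]
  · simp only [growthCoeff_eq_sum, Finset.mul_sum, mul_ite, mul_one, mul_zero]
    rw [Finset.sum_comm]
    refine Finset.sum_congr rfl fun s _ => ?_
    rw [Finset.sum_ite_eq, if_pos (Finset.mem_image_of_mem _ (Finset.mem_univ s))]
  · intro U hU
    have hU' : growthCoeff U T ≠ 0 := fun h => hU (by simp [h])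
    obtain ⟨⟨s, hs⟩⟩ := (Nat.card_ne_zero.1 hU').1
    exact Finset.mem_coe.2 (Finset.mem_image.2 ⟨s, Finset.mem_univ s, hs⟩)

open Classical in
-- A vertex set of a disjoint union is a pair of vertex sets, and the full subgraph on it is the
-- product of the two full subgraphs.
theorem growthCoeff_mul_eq_sum (S T T' : Conf σ q) :
    (growthCoeff S (T * T') : ℝ) = ∑ s : Set T.rep.V, ∑ t : Set T'.rep.V,
      if mk (T.rep.restrict s) * mk (T'.rep.restrict t) = S then 1 else 0 := by
  obtain ⟨f, hf⟩ := ColEmb.exists_rep (T.rep.disjointUnion T'.rep)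
  have h := growthCoeff_of_emb (T := T * T') f S
  rw [h]
  let e : {w : Set (T.rep.disjointUnion T'.rep).V // w ⊆ Set.range f.emb ∧
      mk ((T.rep.disjointUnion T'.rep).restrict w) = S} ≃
      {p : Set T.rep.V × Set T'.rep.V //
        mk (T.rep.restrict p.1) * mk (T'.rep.restrict p.2) = S} :=
    (Set.sumEquiv (α := T.rep.V) (β := T'.rep.V)).toEquiv.subtypeEquiv fun w => by
      refine ⟨fun h => (mk_restrict_disjointUnion _ _ w).symm.trans h.2, fun h =>
        ⟨fun x _ => hf x, (mk_restrict_disjointUnion _ _ w).trans h⟩⟩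
  rw [Nat.card_congr e, Nat.card_eq_fintype_card, Fintype.card_subtype, ← Finset.sum_boole,
    Fintype.sum_prod_type]

/-- Growth functions are group-like. -/
theorem finsum_covering_mul_growthCoeff {m : ℕ} (S : Fin m → Conf σ q) (T : Conf σ q) :
    ∑ᶠ U : Conf σ q, (U.covering S : ℝ) * growthCoeff U T = ∏ i, (growthCoeff (S i) T : ℝ) := by
  classical
  rw [finsum_mul_growthCoeff (fun U => (U.covering S : ℝ))]
  -- The tuples of subgraphs of `T` of the prescribed types are sorted by their union `u`. The fiber
  -- over `u` is what the covering coefficient counts.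
  have h : ∀ u : Set T.rep.V, (mk (T.rep.restrict u)).covering S =
      Nat.card {s : {s : Fin m → Set T.rep.V // ∀ i, mk (T.rep.restrict (s i)) = S i} //
        (⋃ i, s.1 i) = u} := fun u => by
    obtain ⟨f, hf⟩ := ColEmb.exists_rep_restrict T.rep u
    rw [covering_of_emb f, hf]
    exact Nat.card_congr (Equiv.subtypeSubtypeEquivSubtypeInter
      (fun s : Fin m → Set T.rep.V => ∀ i, mk (T.rep.restrict (s i)) = S i)
      (fun s => (⋃ i, s i) = u)).symm
  simp only [h]
  rw [← Nat.cast_sum, ← Nat.card_sigma, Nat.card_congr (Equiv.sigmaFiberEquiv _),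
    Nat.card_congr (Equiv.subtypePiEquivPi (p := fun i s => mk (T.rep.restrict s) = S i)),
    Nat.card_pi, Nat.cast_prod]
  rfl

end Conf

/-! ### The logarithm as the derivative at zero of `k ↦ 𝒜(T ^ k)` -/

namespace ConfAlg

variable {G : Type u} {σ : G → G} {q : ℕ}

theorem growth_one : growth (1 : Conf σ q) = one := by
  funext S
  simp only [growth, one]
  split_ifs with h
  · rw [h, Conf.growthCoeff_one, Nat.cast_one]
  · by_contra hne
    have := Conf.card_le_of_growthCoeff_ne_zero (fun h0 => hne (by rw [h0, Nat.cast_zero]))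
    rw [Conf.card_one, Nat.le_zero, Conf.card_eq_zero_iff] at this
    exact h this

variable [Finite G]

theorem growth_mul (T T' : Conf σ q) : growth (T * T') = mul (growth T) (growth T') := by
  classical
  funext S
  simp only [growth, mul]
  rw [Conf.growthCoeff_mul_eq_sum]
  simp only [Conf.growthCoeff_eq_sum, Finset.sum_mul_sum]
  symm
  rw [Finset.sum_comm]
  refine Finset.sum_congr rfl fun s _ => ?_
  rw [Finset.sum_comm]
  refine Finset.sum_congr rfl fun t _ => ?_
  trans ∑ p ∈ (Conf.finite_mul_eq S).toFinset,
    if (Conf.mk (T.rep.restrict s), Conf.mk (T'.rep.restrict t)) = p then (1 : ℝ) else 0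
  · refine Finset.sum_congr rfl fun p _ => ?_
    simp only [Prod.ext_iff, ite_and, ite_mul, one_mul, zero_mul]
  · rw [Finset.sum_ite_eq]
    simp

theorem mul_add' (f g h : ConfAlg σ q) : mul f (g + h) = mul f g + mul f h := by
  funext S
  simp [mul, mul_add, Finset.sum_add_distrib]

theorem mul_one' (f : ConfAlg σ q) : mul f one = f := by
  classical
  funext S
  rw [mul, Finset.sum_eq_single (S, 1)]
  · simp [one]
  · rintro ⟨a, b⟩ h hne
    have hab : a * b = S := by simpa using h
    have hb : b ≠ 1 := fun hb => hne (by rw [← hab, hb, Conf.mul_one'])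
    simp [one, hb]
  · intro h
    exact absurd (by simp [Conf.mul_one']) h

theorem sum_smul_mul {ι : Type*} (s : Finset ι) (c : ι → ℝ) (f : ι → ConfAlg σ q)
    (g : ConfAlg σ q) : mul (∑ i ∈ s, c i • f i) g = ∑ i ∈ s, c i • mul (f i) g := by
  funext S
  simp only [mul, Finset.sum_apply, Pi.smul_apply, smul_eq_mul, Finset.sum_mul, Finset.mul_sum]
  rw [Finset.sum_comm]
  simp only [mul_assoc]

/-- Each of the `n` factors contributes at least one vertex. -/
theorem pow_apply_eq_zero {f : ConfAlg σ q} (hf : f 1 = 0) (n : ℕ) {S : Conf σ q}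
    (hS : S.card < n) : pow f n S = 0 := by
  induction n generalizing S with
  | zero => omega
  | succ n ih =>
    refine Finset.sum_eq_zero fun p hp => ?_
    have hp' : p.1 * p.2 = S := by simpa using hp
    by_cases h : p.2 = 1
    · rw [h, hf, mul_zero]
    · rw [ih, zero_mul]
      have := Conf.card_mul p.1 p.2
      have := Conf.card_pos h
      rw [hp'] at *
      omega

/-- The binomial formula for `(1 + f) ^ k`. -/
theorem pow_add_one (f : ConfAlg σ q) (k : ℕ) :
    pow (f + one) k = ∑ n ∈ Finset.range (k + 1), (k.choose n : ℝ) • pow f n := by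
  induction k with
  | zero => simp [pow]
  | succ k ih =>
    rw [pow, mul_add', mul_one', ih, sum_smul_mul, Finset.sum_range_succ' _ (k + 1)]
    simp only [Nat.choose_succ_succ, Nat.cast_add, add_smul, Finset.sum_add_distrib]
    rw [add_assoc]
    congr 1
    have := Finset.sum_range_succ' (fun n => (k.choose n : ℝ) • pow f n) (k + 1)
    rw [Finset.sum_range_succ] at this
    simpa using this

/-- Powers of a configuration. -/
noncomputable def _root_.Conf.npow (T : Conf σ q) : ℕ → Conf σ q
  | 0 => 1
  | n + 1 => Conf.npow T n * T

theorem growth_npow (T : Conf σ q) (k : ℕ) : growth (T.npow k) = pow (growth T) k := by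
  induction k with
  | zero => exact growth_one
  | succ k ih => rw [Conf.npow, growth_mul, ih, pow]

/-- The binomial coefficient `x ↦ x.choose n` as a polynomial. -/
noncomputable def _root_.Polynomial.binom (n : ℕ) : Polynomial ℝ :=
  Polynomial.C ((n.factorial : ℝ)⁻¹) * descPochhammer ℝ n

theorem _root_.Polynomial.binom_eval_natCast (n k : ℕ) :
    (Polynomial.binom n).eval (k : ℝ) = k.choose n := by
  rw [Polynomial.binom, Polynomial.eval_mul, Polynomial.eval_C,
    descPochhammer_eval_eq_descFactorial, Nat.descFactorial_eq_factorial_mul_choose]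
  have := Nat.factorial_ne_zero n
  push_cast
  field_simp

theorem _root_.descPochhammer_eval_neg_one (n : ℕ) :
    (descPochhammer ℝ n).eval (-1) = (-1) ^ n * n.factorial := by
  induction n with
  | zero => simp
  | succ n ih =>
    rw [descPochhammer_succ_right, Polynomial.eval_mul, ih, Nat.factorial_succ]
    simp
    ring

theorem _root_.Polynomial.derivative_binom_eval_zero (n : ℕ) :
    (Polynomial.binom (n + 1)).derivative.eval 0 = (-1 : ℝ) ^ n / (n + 1) := by
  have := Nat.factorial_ne_zero n
  have h : ((n : ℝ) + 1) ≠ 0 := by positivity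
  rw [Polynomial.binom, descPochhammer_succ_left]
  simp [Polynomial.derivative_mul, descPochhammer_eval_neg_one, Nat.factorial_succ]
  field_simp

/-- The polynomial with the values `A(S, T ^ k)` at `k`. -/
noncomputable def growthPoly (T S : Conf σ q) : Polynomial ℝ :=
  ∑ n ∈ Finset.range (S.card + 1),
    Polynomial.C (pow (growth T - one) n S) * Polynomial.binom n

theorem growthPoly_eval_natCast (T S : Conf σ q) (k : ℕ) :
    (growthPoly T S).eval (k : ℝ) = Conf.growthCoeff S (T.npow k) := by
  have h1 : (growth T - one : ConfAlg σ q) 1 = 0 := by simp [growth, one, Conf.growthCoeff_one]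
  have h2 : growth (T.npow k) S = ∑ n ∈ Finset.range (k + 1),
      (k.choose n : ℝ) * pow (growth T - one) n S := by
    rw [growth_npow]
    conv_lhs => rw [← sub_add_cancel (growth T) one]
    rw [pow_add_one]
    simp [Finset.sum_apply]
  change _ = growth (T.npow k) S
  rw [h2, growthPoly, Polynomial.eval_finsetSum]
  simp only [Polynomial.eval_mul, Polynomial.eval_C, Polynomial.binom_eval_natCast, mul_comm]
  -- Both sums are extended to a common range: terms with `n > #S` vanish for degree reasons, terms
  -- with `n > k` because the binomial coefficient does.
  trans ∑ n ∈ Finset.range (S.card + 1 + (k + 1)),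
    (k.choose n : ℝ) * pow (growth T - one) n S
  · refine Finset.sum_subset (Finset.range_mono (by omega)) fun n _ hn => ?_
    rw [pow_apply_eq_zero h1 n (by simpa using hn), mul_zero]
  · refine (Finset.sum_subset (Finset.range_mono (by omega)) fun n _ hn => ?_).symm
    rw [Nat.choose_eq_zero_of_lt (by simpa using hn), Nat.cast_zero, zero_mul]

/-- The derivatives of the binomial polynomials at `0` are the coefficients of the series `log (1 +
x)`. -/
theorem derivative_growthPoly_eval_zero (T S : Conf σ q) :
    (growthPoly T S).derivative.eval 0 = logGrowth T S := by
  rw [growthPoly, Finset.sum_range_succ', logGrowth, log]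
  simp only [Polynomial.derivative_add, Polynomial.derivative_sum, Polynomial.derivative_C_mul,
    Polynomial.eval_add, Polynomial.eval_finsetSum, Polynomial.eval_mul, Polynomial.eval_C,
    Polynomial.derivative_binom_eval_zero]
  simp [Polynomial.binom, mul_comm]

theorem _root_.Polynomial.eq_of_eval_natCast_eq {p r : Polynomial ℝ}
    (h : ∀ k : ℕ, p.eval (k : ℝ) = r.eval (k : ℝ)) : p = r :=
  Polynomial.eq_of_infinite_eval_eq p r
    ((Set.infinite_range_of_injective Nat.cast_injective).mono (by rintro _ ⟨k, rfl⟩; exact h k))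

/-- Group-likeness of `𝒜(T ^ k)` for all `k` is an identity of polynomials in `k`. Its derivative at
`0` is the Lie-like condition: by the product rule, all factors but one are evaluated at `0`, where
they are the coefficients of the unit `𝒜(1)`. -/
theorem logGrowth_mem_lieLike (T : Conf σ q) : logGrowth T ∈ lieLike σ q := by
  classical
  intro m
  funext S
  have hfin : ∀ F : Conf σ q → ℝ, Function.support (fun U => (U.covering S : ℝ) * F U) ⊆
      (Conf.finite_card_le (σ := σ) (q := q) (∑ i, (S i).card)).toFinset := fun F U hU => by
    rw [Set.Finite.coe_toFinset]
    exact Conf.card_le_of_covering_ne_zero U S fun h => hU (by simp [h])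
  have key : ∑ U ∈ (Conf.finite_card_le (σ := σ) (q := q) (∑ i, (S i).card)).toFinset,
      Polynomial.C (U.covering S : ℝ) * growthPoly T U = ∏ i, growthPoly T (S i) := by
    refine Polynomial.eq_of_eval_natCast_eq fun k => ?_
    simp only [Polynomial.eval_finsetSum, Polynomial.eval_mul, Polynomial.eval_C,
      Polynomial.eval_prod, growthPoly_eval_natCast]
    rw [← Conf.finsum_covering_mul_growthCoeff]
    exact (finsum_eq_sum_of_support_subset _ (hfin _)).symm
  have h0 : ∀ j, (growthPoly T (S j)).eval 0 = if S j = 1 then 1 else 0 := fun j => by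
    have := growthPoly_eval_natCast T (S j) 0
    rw [Nat.cast_zero] at this
    rw [this]
    exact congrFun growth_one (S j)
  have h := congrArg (fun p => Polynomial.eval 0 (Polynomial.derivative p)) key
  simp only [Polynomial.derivative_sum, Polynomial.derivative_C_mul, Polynomial.eval_finsetSum,
    Polynomial.eval_mul, Polynomial.eval_C, derivative_growthPoly_eval_zero,
    Polynomial.derivative_prod_finset, Polynomial.eval_prod, h0] at h
  rw [coproduct, finsum_eq_sum_of_support_subset _ (hfin _), h, Finset.sum_apply]
  refine Finset.sum_congr rfl fun i _ => ?_
  rw [slot, Finset.prod_boole]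
  simp only [Finset.mem_erase, Finset.mem_univ, and_true]
  split_ifs <;> simp

/-- A connected `S` factors only as `S * 1` and `1 * S`, so only two terms of the product formula
survive. -/
theorem growthCoeff_mul_of_isConnected {S : Conf σ q} (hS : S.IsConnected) (T T' : Conf σ q) :
    Conf.growthCoeff S (T * T') = Conf.growthCoeff S T + Conf.growthCoeff S T' := by
  classical
  have h := congrFun (growth_mul T T') S
  have hne : ((S, 1) : Conf σ q × Conf σ q) ≠ (1, S) := fun h => hS.ne_one (Prod.ext_iff.1 h).1
  have hF : (Conf.finite_mul_eq S).toFinset = {(S, 1), (1, S)} := by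
    ext ⟨a, b⟩
    simp only [Set.Finite.mem_toFinset, Set.mem_ofPred_eq, Finset.mem_insert,
      Finset.mem_singleton, Prod.mk.injEq]
    constructor
    · rintro rfl
      rcases Conf.eq_one_or_eq_one_of_isConnected_mul hS with rfl | rfl
      · exact Or.inr ⟨rfl, (Conf.one_mul' b).symm⟩
      · exact Or.inl ⟨(Conf.mul_one' a).symm, rfl⟩
    · rintro (⟨rfl, rfl⟩ | ⟨rfl, rfl⟩)
      · exact Conf.mul_one' _
      · exact Conf.one_mul' _
  rw [mul, hF, Finset.sum_pair hne] at h
  simp only [growth, Conf.growthCoeff_one, Nat.cast_one, mul_one, one_mul] at h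
  exact_mod_cast h

theorem growthCoeff_npow_of_isConnected {S : Conf σ q} (hS : S.IsConnected) (T : Conf σ q)
    (k : ℕ) : Conf.growthCoeff S (T.npow k) = k * Conf.growthCoeff S T := by
  induction k with
  | zero =>
    rw [zero_mul]
    by_contra h
    have := Conf.card_le_of_growthCoeff_ne_zero h
    rw [Conf.npow, Conf.card_one, Nat.le_zero, Conf.card_eq_zero_iff] at this
    exact hS.ne_one this
  | succ k ih => rw [Conf.npow, growthCoeff_mul_of_isConnected hS, ih, add_mul, one_mul]

theorem logGrowth_of_isConnected {S : Conf σ q} (hS : S.IsConnected) (T : Conf σ q) :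
    logGrowth T S = Conf.growthCoeff S T := by
  have h : growthPoly T S = Polynomial.C (Conf.growthCoeff S T : ℝ) * Polynomial.X := by
    refine Polynomial.eq_of_eval_natCast_eq fun k => ?_
    rw [growthPoly_eval_natCast, growthCoeff_npow_of_isConnected hS]
    simp [mul_comm]
  rw [← derivative_growthPoly_eval_zero, h]
  simp

end ConfAlg

/-! ### Bounded valency and the linear bound for growth coefficients -/

namespace FinGraph

variable {G : Type u} {σ : G → G} {q : ℕ}

/-- The directed edges of a graph joining vertices of a given set. -/
def edgesIn (Γ : FinGraph σ q) (s : Set Γ.V) : Set (Γ.V × Γ.V) :=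
  {p | p.1 ∈ s ∧ p.2 ∈ s ∧ Γ.Adj p.1 p.2}

/-- The vertices at distance at most `n` from a given one. -/
def ball (Γ : FinGraph σ q) (x : Γ.V) : ℕ → Set Γ.V
  | 0 => {x}
  | n + 1 => ball Γ x n ∪ ⋃ y : ball Γ x n, Γ.toColored.graph.neighborSet y.1

theorem ncard_ball_le (Γ : FinGraph σ q) (x : Γ.V) (n : ℕ) :
    (Γ.ball x n).ncard ≤ (1 + q) ^ n := by
  classical
  induction n with
  | zero => simp [ball]
  | succ n ih =>
    have : Fintype (Γ.ball x n) := Fintype.ofFinite _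
    have hN : (⋃ y : Γ.ball x n, Γ.toColored.graph.neighborSet y.1).ncard
        ≤ (Γ.ball x n).ncard * q := by
      refine (Set.ncard_iUnion_le_of_fintype _).trans ?_
      refine (Finset.sum_le_card_nsmul _ _ q fun y _ => Γ.valency_le y.1).trans ?_
      rw [Finset.card_univ, ← Nat.card_eq_fintype_card, Nat.card_coe_set_eq, smul_eq_mul]
    calc (Γ.ball x (n + 1)).ncard ≤ (Γ.ball x n).ncard + (Γ.ball x n).ncard * q :=
          (Set.ncard_union_le _ _).trans (Nat.add_le_add_left hN _)
      _ = (Γ.ball x n).ncard * (1 + q) := by ring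
      _ ≤ (1 + q) ^ (n + 1) := Nat.mul_le_mul_right _ ih

theorem ball_mono (Γ : FinGraph σ q) (x : Γ.V) : Monotone (Γ.ball x) :=
  monotone_nat_of_le_succ fun _ => Set.subset_union_left

theorem mem_ball_of_walk (Γ : FinGraph σ q) {x y z : Γ.V} (w : Γ.toColored.graph.Walk y z)
    {n : ℕ} (hy : y ∈ Γ.ball x n) : z ∈ Γ.ball x (n + w.length) := by
  induction w generalizing n with
  | nil => exact hy
  | @cons a b c h w ih =>
    have := ih (n := n + 1) (Or.inr (Set.mem_iUnion.2 ⟨⟨a, hy⟩, h⟩))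
    rw [SimpleGraph.Walk.length_cons]
    convert this using 2
    omega

/-- A path inside `s` has fewer than `s.ncard` edges. -/
theorem subset_ball (Γ : FinGraph σ q) {s : Set Γ.V}
    (hs : (Γ.restrict s).toColored.graph.Connected) {x : Γ.V} (hx : x ∈ s) :
    s ⊆ Γ.ball x s.ncard := by
  intro y hy
  obtain ⟨w, hw⟩ := (hs.preconnected ⟨x, hx⟩ ⟨y, hy⟩).exists_isPath
  have hlen : w.length < Fintype.card (Γ.restrict s).V := hw.length_lt
  rw [← Nat.card_eq_fintype_card] at hlen
  have hle : w.length ≤ s.ncard := hlen.le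
  have h := Γ.mem_ball_of_walk (n := 0) (x := x) (w.map (ColEmb.ofRestrict Γ s).emb.toHom) rfl
  have hl : 0 + (w.map (ColEmb.ofRestrict Γ s).emb.toHom).length = w.length :=
    (zero_add _).trans (SimpleGraph.Walk.length_map _ _)
  exact Γ.ball_mono x (hl.le.trans hle) h

end FinGraph

namespace Conf

variable {G : Type u} {σ : G → G} {q : ℕ}

/-- A copy of `S` lies in the ball of radius `#S` around any of its vertices, and such a ball has at
most `2 ^ (1 + q) ^ #S` subsets. -/
theorem growthCoeff_le {S : Conf σ q} (hS : S.IsConnected) (T : Conf σ q) :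
    growthCoeff S T ≤ 2 ^ (1 + q) ^ S.card * T.card := by
  have h : {s : Set T.rep.V | mk (T.rep.restrict s) = S} ⊆
      ⋃ x : T.rep.V, 𝒫 (T.rep.ball x S.card) := by
    intro s hs
    have hs' : mk (T.rep.restrict s) = S := hs
    have hc : (T.rep.restrict s).toColored.graph.Connected := isConnected_mk.1 (hs' ▸ hS)
    obtain ⟨⟨x, hx⟩⟩ := hc.nonempty
    refine Set.mem_iUnion.2 ⟨x, ?_⟩
    rw [← hs', card_mk_restrict]
    exact T.rep.subset_ball hc hx
  calc growthCoeff S T = {s : Set T.rep.V | mk (T.rep.restrict s) = S}.ncard := rfl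
    _ ≤ _ := Set.ncard_le_ncard h (Set.toFinite _)
    _ ≤ _ := Set.ncard_iUnion_le_of_fintype _
    _ ≤ Fintype.card T.rep.V • 2 ^ (1 + q) ^ S.card := by
      refine Finset.sum_le_card_nsmul _ _ _ fun x _ => ?_
      rw [Set.ncard_powerset]
      exact Nat.pow_le_pow_right (by norm_num) (T.rep.ncard_ball_le x _)
    _ = _ := by rw [← Nat.card_eq_fintype_card, smul_eq_mul, mul_comm]; rfl

/-! ### Edge counts and the induction order for coverings -/

/-- The number of directed edges. -/
noncomputable def edges (T : Conf σ q) : ℕ := (T.rep.edgesIn Set.univ).ncard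

theorem edges_mk_restrict (Γ : FinGraph σ q) (s : Set Γ.V) :
    (mk (Γ.restrict s)).edges = (Γ.edgesIn s).ncard := by
  obtain ⟨f, hf⟩ := ColEmb.exists_rep_restrict Γ s
  rw [edges, ← Set.ncard_image_of_injective _ (f.injective.prodMap f.injective)]
  congr 1
  ext ⟨x, y⟩
  constructor
  · rintro ⟨⟨a, b⟩, ⟨-, -, h⟩, he⟩
    obtain ⟨rfl, rfl⟩ := Prod.ext_iff.1 he
    exact ⟨hf.subset ⟨a, rfl⟩, hf.subset ⟨b, rfl⟩, f.adj_iff.2 h⟩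
  · rintro ⟨hx, hy, h⟩
    rw [← hf] at hx hy
    obtain ⟨a, rfl⟩ := hx
    obtain ⟨b, rfl⟩ := hy
    exact ⟨(a, b), ⟨trivial, trivial, f.adj_iff.1 h⟩, rfl⟩

theorem edges_mk (Γ : FinGraph σ q) : (mk Γ).edges = (Γ.edgesIn Set.univ).ncard := by
  rw [← edges_mk_restrict, mk_restrict_univ]

theorem edges_le (T : Conf σ q) : T.edges ≤ T.card ^ 2 := by
  refine (Set.ncard_le_card _).trans ?_
  rw [Nat.card_prod, sq]
  rfl

theorem mk_restrict_range {Γ Δ : FinGraph σ q} (f : ColEmb Γ Δ) :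
    mk (Δ.restrict (Set.range f.emb)) = mk Γ := by
  rw [← Set.image_univ, f.mk_restrict_image, mk_restrict_univ]

theorem edges_mul_le (S T : Conf σ q) : (S * T).edges ≤ S.edges + T.edges := by
  have h : (S * T).edges = ((S.rep.disjointUnion T.rep).edgesIn Set.univ).ncard := edges_mk _
  have hS : S.edges =
      ((S.rep.disjointUnion T.rep).edgesIn (Set.range (ColEmb.inl S.rep T.rep).emb)).ncard := by
    rw [← edges_mk_restrict, mk_restrict_range, mk_rep]
  have hT : T.edges =
      ((S.rep.disjointUnion T.rep).edgesIn (Set.range (ColEmb.inr S.rep T.rep).emb)).ncard := by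
    rw [← edges_mk_restrict, mk_restrict_range, mk_rep]
  rw [h, hS, hT]
  refine (Set.ncard_le_ncard ?_).trans (Set.ncard_union_le _ _)
  rintro ⟨x | x, y | y⟩ ⟨-, -, hxy⟩
  · exact Or.inl ⟨⟨x, rfl⟩, ⟨y, rfl⟩, hxy⟩
  · exact absurd hxy (by simp [FinGraph.disjointUnion, FinGraph.Adj])
  · exact absurd hxy (by simp [FinGraph.disjointUnion, FinGraph.Adj])
  · exact Or.inr ⟨⟨x, rfl⟩, ⟨y, rfl⟩, hxy⟩

theorem covering_mul_ne_zero (S T : Conf σ q) : (S * T).covering ![S, T] ≠ 0 := by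
  obtain ⟨f, hf⟩ := ColEmb.exists_rep (S.rep.disjointUnion T.rep)
  rw [covering_of_emb (T := S * T) f]
  refine Nat.card_ne_zero.2 ⟨⟨⟨![Set.range (ColEmb.inl S.rep T.rep).emb,
    Set.range (ColEmb.inr S.rep T.rep).emb], ?_, ?_⟩⟩, inferInstance⟩
  · intro i
    fin_cases i
    · exact (mk_restrict_range _).trans (mk_rep S)
    · exact (mk_restrict_range _).trans (mk_rep T)
  · rw [hf.range_eq, Set.eq_univ_iff_forall]
    rintro (x | x)
    · exact Set.mem_iUnion.2 ⟨0, x, rfl⟩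
    · exact Set.mem_iUnion.2 ⟨1, x, rfl⟩

/-- A complexity which decreases with the degree and, in each degree, with growing number of
edges. -/
noncomputable def complexity (T : Conf σ q) : ℕ := (T.card + 1) ^ 3 - T.edges

/-- If `U` has fewer vertices than `S * T`, the gap between consecutive cubes exceeds any edge
count, since `edges ≤ card ^ 2`. This bound also keeps the natural subtraction from truncating. With
equally many vertices the two covering parts are disjoint, and `U ≠ S * T` forces an edge between
them. -/
theorem complexity_lt {S T U : Conf σ q} (hU : U.covering ![S, T] ≠ 0) (hne : U ≠ S * T) :
    U.complexity < (S * T).complexity := by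
  have hle := card_le_of_covering_ne_zero U _ hU
  simp only [Fin.sum_univ_two, Matrix.cons_val_zero, Matrix.cons_val_one, ← card_mul] at hle
  have h1 := edges_le (S * T)
  have h2 := edges_le U
  unfold complexity
  rcases hle.lt_or_eq with hlt | heq
  · have h3 : (U.card + 1) ^ 3 ≤ (S * T).card ^ 3 := Nat.pow_le_pow_left hlt 3
    have h4 : ((S * T).card + 1) ^ 3 =
      (S * T).card ^ 3 + 3 * (S * T).card ^ 2 + 3 * (S * T).card + 1 := by ring
    omega
  · obtain ⟨⟨s, hs, hcov⟩⟩ := (Nat.card_ne_zero.1 hU).1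
    have hs0 : mk (U.rep.restrict (s 0)) = S := hs 0
    have hs1 : mk (U.rep.restrict (s 1)) = T := hs 1
    have hun : s 0 ∪ s 1 = Set.univ := by
      rw [← hcov]
      ext x
      simp [Fin.exists_fin_two]
    have hdisj : Disjoint (s 0) (s 1) := by
      rw [← Set.ncard_union_eq_iff, hun, ← card_mk_restrict U.rep (s 0),
        ← card_mk_restrict U.rep (s 1), hs0, hs1, Set.ncard_univ, ← card_mul, ← heq]
      rfl
    have hex : ∃ x ∈ s 0, ∃ y ∈ s 1, U.rep.Adj x y := by
      by_contra! h
      have := mk_restrict_mul_restrict hun hdisj h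
      rw [hs0, hs1, mk_restrict_univ, mk_rep] at this
      exact hne this.symm
    obtain ⟨x, hx, y, hy, hxy⟩ := hex
    have hxs : x ∉ s 1 := Set.disjoint_left.1 hdisj hx
    have hys : y ∉ s 0 := Set.disjoint_right.1 hdisj hy
    have hE : S.edges + T.edges + 1 ≤ U.edges := by
      rw [← hs0, ← hs1, edges_mk_restrict, edges_mk_restrict, ← Set.ncard_union_eq, edges,
        ← Set.ncard_insert_of_notMem (a := (x, y))]
      · refine Set.ncard_le_ncard ?_
        rintro p (rfl | hp | hp)
        · exact ⟨trivial, trivial, hxy⟩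
        · exact ⟨trivial, trivial, hp.2.2⟩
        · exact ⟨trivial, trivial, hp.2.2⟩
      · rintro (hp | hp)
        · exact hys hp.2.1
        · exact hxs hp.1
      · exact Set.disjoint_left.2 fun p hp hp' => Set.disjoint_left.1 hdisj hp.1 hp'.1
    have := edges_mul_le S T
    have h4 : ((S * T).card + 1) ^ 3 =
      (S * T).card ^ 3 + 3 * (S * T).card ^ 2 + 3 * (S * T).card + 1 := by ring
    rw [heq] at *
    omega

end Conf

/-! ### Lie-like elements are determined by connected coefficients -/

namespace ConfAlg

variable {G : Type u} [Finite G] {σ : G → G} {q : ℕ}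

/-- This is the case `m = 0`: the empty tuple covers only the empty graph, and the right-hand side
is an empty sum. -/
theorem apply_one_of_mem_lieLike {f : ConfAlg σ q} (hf : f ∈ lieLike σ q) : f 1 = 0 := by
  have h := congrFun (hf 0) ![]
  rw [coproduct, finsum_eq_single _ 1] at h
  · have hne : (1 : Conf σ q).covering ![] ≠ 0 := by
      refine Nat.card_ne_zero.2 ⟨⟨⟨![], fun i => i.elim0, ?_⟩⟩, inferInstance⟩
      have : IsEmpty (1 : Conf σ q).rep.V := by
        rw [← Finite.card_eq_zero_iff]
        exact Conf.card_one
      exact Set.ext fun x => isEmptyElim x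
    simpa [hne] using h
  · intro U hU
    have : U.covering ![] = 0 := by
      by_contra hc
      have := Conf.card_le_of_covering_ne_zero U _ hc
      rw [Finset.univ_eq_empty, Finset.sum_empty, Nat.le_zero] at this
      exact hU (Conf.card_eq_zero_iff.1 this)
    rw [this, Nat.cast_zero, zero_mul]

/-- The coefficients of Lie-like elements are linear combinations of the coefficients at
connected configurations. -/
theorem coeff_mem_span (S : Conf σ q) :
    (fun f : lieLike σ q => f.1 S) ∈
      Submodule.span ℝ (Set.range fun (U : Conf₀ σ q) (f : lieLike σ q) => f.1 U.1) := by
  classical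
  induction h : S.complexity using Nat.strong_induction_on generalizing S with
  | _ n ih =>
  subst h
  by_cases hS : S.IsConnected
  · exact Submodule.subset_span ⟨⟨S, hS⟩, rfl⟩
  by_cases h1 : S = 1
  · convert Submodule.zero_mem _ using 1
    funext f
    rw [h1]
    exact apply_one_of_mem_lieLike f.2
  obtain ⟨S₁, S₂, h₁, h₂, rfl⟩ := Conf.exists_mul_eq h1 hS
  let F := (Conf.finite_card_le (σ := σ) (q := q) (∑ i, (![S₁, S₂] i).card)).toFinset
  have hcov := Conf.covering_mul_ne_zero S₁ S₂
  have hmem : S₁ * S₂ ∈ F := by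
    rw [Set.Finite.mem_toFinset]
    exact Conf.card_le_of_covering_ne_zero _ _ hcov
  have key : (fun f : lieLike σ q => f.1 (S₁ * S₂)) =
      (-((S₁ * S₂).covering ![S₁, S₂] : ℝ)⁻¹) •
        ∑ U ∈ F.erase (S₁ * S₂), (U.covering ![S₁, S₂] : ℝ) • fun f : lieLike σ q => f.1 U := by
    funext f
    -- Both slots vanish because neither `S₁` nor `S₂` is `1`. This equation is then solved for the
    -- coefficient at `S₁ * S₂`, whose factor is nonzero.
    have h0 : coproduct 2 f.1 ![S₁, S₂] = 0 := by
      rw [f.2 2, Finset.sum_apply, Fin.sum_univ_two, slot, slot, if_neg, if_neg, add_zero]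
      · exact fun h => h₁ (h 0 (by decide))
      · exact fun h => h₂ (h 1 (by decide))
    rw [coproduct, finsum_eq_sum_of_support_subset (s := F), ← Finset.add_sum_erase _ _ hmem] at h0
    · have hc : ((S₁ * S₂).covering ![S₁, S₂] : ℝ) ≠ 0 := Nat.cast_ne_zero.2 hcov
      simp only [Pi.smul_apply, Finset.sum_apply, smul_eq_mul]
      field_simp
      linarith
    · intro U hU
      rw [Set.Finite.coe_toFinset]
      exact Conf.card_le_of_covering_ne_zero U _ fun h => hU (by simp [h])
  rw [key]
  refine Submodule.smul_mem _ _ (Submodule.sum_mem _ fun U hU => ?_)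
  by_cases hU0 : U.covering ![S₁, S₂] = 0
  · rw [hU0, Nat.cast_zero, zero_smul]
    exact Submodule.zero_mem _
  · exact Submodule.smul_mem _ _
      (ih _ (Conf.complexity_lt hU0 (Finset.ne_of_mem_erase hU)) U rfl)

theorem eq_of_forall_isConnected {f g : ConfAlg σ q} (hf : f ∈ lieLike σ q) (hg : g ∈ lieLike σ q)
    (h : ∀ S : Conf σ q, S.IsConnected → f S = g S) : f = g := by
  funext S
  refine Submodule.span_induction
    (p := fun (φ : lieLike σ q → ℝ) _ => φ ⟨f, hf⟩ = φ ⟨g, hg⟩) ?_ rfl ?_ ?_ (coeff_mem_span S)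
  · rintro _ ⟨U, rfl⟩
    exact h U.1 U.2
  · intro φ ψ _ _ h1 h2
    simp only [Pi.add_apply, h1, h2]
  · intro c φ _ h1
    simp only [Pi.smul_apply, h1]

/-- Both sides are Lie-like, and at connected configurations `ℳ` agrees with `𝒜`, which is additive
there. No functional equation of `log` is needed. -/
theorem logGrowth_mul (T T' : Conf σ q) :
    logGrowth (T * T') = logGrowth T + logGrowth T' := by
  refine eq_of_forall_isConnected (logGrowth_mem_lieLike _)
    (add_mem (logGrowth_mem_lieLike _) (logGrowth_mem_lieLike _)) fun S hS => ?_
  rw [Pi.add_apply]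
  simp only [logGrowth_of_isConnected hS]
  exact_mod_cast growthCoeff_mul_of_isConnected hS T T'

/-- Linear bounds pass to linear combinations, so the bound for connected configurations suffices.
It yields both the compactness of `Ω` and the convergence of the weighted sums. -/
theorem exists_abs_logGrowth_le (S : Conf σ q) :
    ∃ C : ℝ, ∀ T : Conf σ q, |logGrowth T S| ≤ C * T.card := by
  refine Submodule.span_induction (p := fun (φ : lieLike σ q → ℝ) _ => ∃ C : ℝ,
    ∀ T : Conf σ q, |φ ⟨logGrowth T, logGrowth_mem_lieLike T⟩| ≤ C * T.card) ?_
    ⟨0, fun T => by simp⟩ ?_ ?_ (coeff_mem_span S)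
  · rintro _ ⟨U, rfl⟩
    refine ⟨2 ^ (1 + q) ^ U.1.card, fun T => ?_⟩
    simp only
    rw [logGrowth_of_isConnected U.2, Nat.abs_cast]
    exact_mod_cast Conf.growthCoeff_le U.2 T
  · rintro φ ψ _ _ ⟨C, hC⟩ ⟨D, hD⟩
    refine ⟨C + D, fun T => ?_⟩
    rw [add_mul]
    exact (abs_add_le _ _).trans (add_le_add (hC T) (hD T))
  · rintro c φ _ ⟨C, hC⟩
    refine ⟨|c| * C, fun T => ?_⟩
    rw [Pi.smul_apply, smul_eq_mul, abs_mul, mul_assoc]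
    exact mul_le_mul_of_nonneg_left (hC T) (abs_nonneg c)

end ConfAlg

/-! ### Inversion of growth coefficients by kabi coefficients -/

namespace FinGraph

variable {G : Type u} {σ : G → G} {q : ℕ}

/-- The vertices outside a set which are adjacent to a vertex of the set. -/
def boundary (Γ : FinGraph σ q) (s : Set Γ.V) : Set Γ.V := {x | x ∉ s ∧ ∃ y ∈ s, Γ.Adj x y}

theorem connected_restrict_of_subset (Γ : FinGraph σ q) {s t : Set Γ.V}
    (hs : (Γ.restrict s).toColored.graph.Connected) (hst : s ⊆ t) (hts : t ⊆ s ∪ Γ.boundary s) :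
    (Γ.restrict t).toColored.graph.Connected := by
  let i : Γ.toColored.graph.induce s →g Γ.toColored.graph.induce t :=
    ⟨Set.inclusion hst, fun {_ _} h => h⟩
  obtain ⟨x⟩ := hs.nonempty
  refine SimpleGraph.connected_iff_exists_forall_reachable _ |>.2 ⟨i x, fun z => ?_⟩
  rcases hts z.2 with hz | ⟨-, y, hy, hzy⟩
  · exact (hs.preconnected x ⟨z.1, hz⟩).map i
  · refine ((hs.preconnected x ⟨y, hy⟩).map i).trans (SimpleGraph.Adj.reachable ?_)
    exact SimpleGraph.Adj.symm (G := Γ.toColored.graph) hzy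

theorem eq_univ_of_boundary_eq_empty (Γ : FinGraph σ q) (hΓ : Γ.toColored.graph.Connected)
    {s : Set Γ.V} (hs : s.Nonempty) (hb : Γ.boundary s = ∅) : s = Set.univ :=
  hΓ.preconnected.eq_univ_of_forall_not_adj hs fun x hx y hy h =>
    (hb.subset ⟨hy, x, hx, SimpleGraph.Adj.symm h⟩ : y ∈ (∅ : Set Γ.V))

end FinGraph

open Classical in
-- Up to the even power `2 * u.ncard`, this is the alternating sum over the subsets `s \ u` of `b`.
theorem Set.sum_neg_one_pow_ncard {V : Type*} [Fintype V] (u b : Set V) (hub : Disjoint u b) :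
    (∑ s : Set V, if u ⊆ s ∧ s ⊆ u ∪ b then (-1 : ℝ) ^ (u.ncard + s.ncard) else 0) =
      if b = ∅ then 1 else 0 := by
  have h : (∑ m ∈ b.toFinset.powerset, (-1 : ℝ) ^ m.card) = if b = ∅ then 1 else 0 := by
    have := Finset.sum_powerset_neg_one_pow_card (x := b.toFinset)
    simp only [Set.toFinset_eq_empty] at this
    have h2 := congrArg (Int.cast : ℤ → ℝ) this
    push_cast at h2
    exact h2
  rw [← h, ← Finset.sum_filter]
  refine Finset.sum_nbij' (fun s => (s \ u).toFinset) (fun t => u ∪ (t : Set V)) ?_ ?_ ?_ ?_ ?_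
  · intro s hs
    rw [Finset.mem_filter] at hs
    rw [Finset.mem_powerset, Set.toFinset_subset_toFinset]
    exact Set.sdiff_subset_iff.2 hs.2.2
  · intro t ht
    rw [Finset.mem_filter]
    refine ⟨Finset.mem_univ _, Set.subset_union_left, Set.union_subset_union_right _ ?_⟩
    intro x hx
    exact Set.mem_toFinset.1 (Finset.mem_powerset.1 ht hx)
  · intro s hs
    rw [Finset.mem_filter] at hs
    simp only [Set.coe_toFinset]
    exact Set.union_sdiff_cancel hs.2.1
  · intro t ht
    ext x
    have : x ∈ t → x ∉ u := fun hx hu => Set.disjoint_left.1 hub hu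
      (Set.mem_toFinset.1 (Finset.mem_powerset.1 ht hx))
    simp only [Set.mem_toFinset, Set.mem_sdiff, Set.mem_union, Finset.mem_coe]
    tauto
  · intro s hs
    rw [Finset.mem_filter] at hs
    rw [← Set.ncard_eq_toFinset_card', ← Set.ncard_sdiff_add_ncard_of_subset hs.2.1,
      show u.ncard + ((s \ u).ncard + u.ncard) = (s \ u).ncard + 2 * u.ncard by ring, pow_add,
      pow_mul]
    simp

namespace Conf

variable {G : Type u} {σ : G → G} {q : ℕ}

open Classical in
theorem finsum_connected_mul_growthCoeff (F : Conf σ q → ℝ) (T : Conf σ q) :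
    ∑ᶠ U : Conf₀ σ q, F U.1 * growthCoeff U.1 T = ∑ s : Set T.rep.V,
      if (mk (T.rep.restrict s)).IsConnected then F (mk (T.rep.restrict s)) else 0 := by
  rw [← finsum_mul_growthCoeff (fun U => if U.IsConnected then F U else 0)]
  refine (finsum_subtype_eq_finsum_cond (f := fun U : Conf σ q => F U * growthCoeff U T)
    Conf.IsConnected).trans (finsum_congr fun U => ?_)
  by_cases h : U.IsConnected <;> simp [h]

open Classical in
theorem kabiCoeff_mk_restrict (Γ : FinGraph σ q) (s : Set Γ.V) (U : Conf σ q) :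
    (kabiCoeff U (mk (Γ.restrict s)) : ℝ) = ∑ u : Set Γ.V,
      if mk (Γ.restrict u) = U ∧ u ⊆ s ∧ s ⊆ u ∪ Γ.boundary u then 1 else 0 := by
  obtain ⟨f, hf⟩ := ColEmb.exists_rep_restrict Γ s
  rw [kabiCoeff_of_emb f, Nat.card_eq_fintype_card, Fintype.card_subtype, Finset.sum_boole]
  congr 2
  ext u
  simp only [Finset.mem_filter, Finset.mem_univ, true_and, hf]
  refine ⟨fun h => ⟨h.2.1, h.1, fun x hx => ?_⟩, fun h => ⟨h.2.1, h.1, fun x hx hxu => ?_⟩⟩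
  · by_cases hxu : x ∈ u
    · exact Or.inl hxu
    · exact Or.inr ⟨hxu, h.2.2 x hx hxu⟩
  · exact ((h.2.2 hx).resolve_left hxu).2

open Classical in
/-- The kabi coefficients are inverse, up to signs, to the growth coefficients of connected
configurations. -/
theorem finsum_kabiCoeff_mul_growthCoeff (U T : Conf₀ σ q) :
    ∑ᶠ S : Conf₀ σ q, (-1 : ℝ) ^ (U.1.card + S.1.card) * (kabiCoeff U.1 S.1 : ℝ) *
      growthCoeff S.1 T.1 = if U = T then 1 else 0 := by
  rw [finsum_connected_mul_growthCoeff
    (fun S => (-1 : ℝ) ^ (U.1.card + S.card) * (kabiCoeff U.1 S : ℝ))]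
  have hT : T.1.rep.toColored.graph.Connected := T.2
  simp only [kabiCoeff_mk_restrict, Finset.mul_sum, mul_ite, mul_one, mul_zero]
  -- The sum now runs over pairs `u ⊆ s ⊆ u ∪ ∂u` with `u` of type `U`. Such an `s` is connected
  -- because `u` is, so the connectedness condition can be dropped.
  have key : ∀ s : Set T.1.rep.V,
      (if (mk (T.1.rep.restrict s)).IsConnected then
        ∑ u : Set T.1.rep.V, if mk (T.1.rep.restrict u) = U.1 ∧ u ⊆ s ∧
          s ⊆ u ∪ T.1.rep.boundary u then
          (-1 : ℝ) ^ (U.1.card + (mk (T.1.rep.restrict s)).card) else 0 else 0) =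
      ∑ u : Set T.1.rep.V, if mk (T.1.rep.restrict u) = U.1 then
        (if u ⊆ s ∧ s ⊆ u ∪ T.1.rep.boundary u then
          (-1 : ℝ) ^ (u.ncard + s.ncard) else 0) else 0 := fun s => by
    split_ifs with hs
    · refine Finset.sum_congr rfl fun u _ => ?_
      rw [← ite_and]
      split_ifs with h
      · rw [← h.1, card_mk_restrict, card_mk_restrict]
      · rfl
    · refine (Finset.sum_eq_zero fun u _ => ?_).symm
      rw [← ite_and, if_neg]
      rintro ⟨h1, h2, h3⟩
      exact hs (isConnected_mk.2 (T.1.rep.connected_restrict_of_subset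
        (isConnected_mk.1 (h1 ▸ U.2)) h2 h3))
  -- For fixed `u` the alternating sum over `s` vanishes unless `∂u` is empty. As `T` is connected
  -- and `u` nonempty, only the whole vertex set remains.
  rw [Finset.sum_congr rfl fun s _ => key s, Finset.sum_comm, Finset.sum_eq_single Set.univ]
  · have hb : T.1.rep.boundary Set.univ = ∅ :=
      Set.eq_empty_of_forall_notMem fun x hx => hx.1 trivial
    rw [mk_restrict_univ, mk_rep]
    by_cases h : T.1 = U.1
    · simp only [if_pos h]
      rw [Set.sum_neg_one_pow_ncard _ _ (hb ▸ Set.disjoint_empty _), if_pos hb,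
        if_pos (Subtype.ext h.symm)]
    · rw [if_neg fun h' => h (congrArg Subtype.val h').symm]
      simp [h]
  · intro u _ hu
    by_cases h : mk (T.1.rep.restrict u) = U.1
    · simp only [if_pos h]
      rw [Set.sum_neg_one_pow_ncard _ _ (Set.disjoint_left.2 fun x hx hx' => hx'.1 hx), if_neg]
      intro hb
      refine hu (T.1.rep.eq_univ_of_boundary_eq_empty hT ?_ hb)
      refine Set.nonempty_iff_ne_empty.2 fun h0 => U.2.ne_one ?_
      rw [← h, mk_restrict_eq_one, h0]
    · simp [h]
  · exact fun h => absurd (Finset.mem_univ _) h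

end Conf

/-! ### The classical topology is coefficientwise convergence -/

theorem continuous_moduleTopology_dom {Q : Type*} [AddCommGroup Q] [Module ℝ Q]
    (φ : Q →ₗ[ℝ] ℝ) : @Continuous Q ℝ (moduleTopology ℝ Q) _ φ := by
  let _ : TopologicalSpace Q := moduleTopology ℝ Q
  have : IsModuleTopology ℝ Q := ⟨rfl⟩
  exact IsModuleTopology.continuous_of_linearMap φ

theorem continuous_moduleTopology_cod {Q ι : Type*} [AddCommGroup Q] [Module ℝ Q] [Finite ι]
    (g : (ι → ℝ) →ₗ[ℝ] Q) : @Continuous (ι → ℝ) Q _ (moduleTopology ℝ Q) g := by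
  let _ : TopologicalSpace Q := moduleTopology ℝ Q
  have : IsModuleTopology ℝ Q := ⟨rfl⟩
  have : ContinuousAdd Q := IsModuleTopology.toContinuousAdd ℝ Q
  exact IsModuleTopology.continuous_of_linearMap g

namespace LieSpace

variable {G : Type u} [Finite G] {σ : G → G} {q : ℕ}

theorem toConfAlg_injective : Function.Injective (toConfAlg (σ := σ) (q := q)) :=
  Subtype.val_injective

theorem continuous_coeff (S : Conf σ q) : Continuous fun x : LieSpace σ q => x.toConfAlg S := by
  let N := degreeGE σ q (S.card + 1)
  let φ : (LieSpace σ q ⧸ N) →ₗ[ℝ] ℝ := N.liftQ (LinearMap.proj S ∘ₗ toConfAlg)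
    fun x hx => LinearMap.mem_ker.2 (hx S (Nat.lt_succ_self _))
  have h := continuous_moduleTopology_dom φ
  exact (continuous_iff_le_induced.2 (iInf_le_of_le (S.card + 1)
    (continuous_iff_le_induced.1 (@Continuous.comp _ _ _
      (TopologicalSpace.induced N.mkQ (moduleTopology ℝ (LieSpace σ q ⧸ N)))
      (moduleTopology ℝ (LieSpace σ q ⧸ N)) _ _ _ h continuous_induced_dom))))

/-- The classical topology is the topology of coefficientwise convergence. -/
theorem isInducing_toConfAlg : Topology.IsInducing (toConfAlg (σ := σ) (q := q)) := by
  refine ⟨le_antisymm ?_ ?_⟩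
  · exact continuous_iff_le_induced.1 (continuous_pi continuous_coeff)
  · refine le_iInf fun n => continuous_iff_le_induced.1 ?_
    let N := degreeGE σ q n
    let ι := {S : Conf σ q // S.card < n}
    have hι : Finite ι :=
      ((Conf.finite_card_le (σ := σ) (q := q) n).subset
        fun S (hS : S.card < n) => le_of_lt hS).to_subtype
    let r : ConfAlg σ q →ₗ[ℝ] (ι → ℝ) := LinearMap.funLeft ℝ ℝ Subtype.val
    let l : (LieSpace σ q ⧸ N) →ₗ[ℝ] (ι → ℝ) := N.liftQ (r ∘ₗ toConfAlg)
      fun x hx => LinearMap.mem_ker.2 (funext fun S => hx S.1 S.2)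
    have hl : LinearMap.ker l = ⊥ := by
      refine Submodule.ker_liftQ_eq_bot _ _ _ fun x hx S hS => ?_
      exact congrFun (show r x.toConfAlg = 0 from hx) ⟨S, hS⟩
    -- The finitely many coefficients of degree less than `n` embed the quotient in a
    -- finite-dimensional space. A linear left inverse makes the projection a continuous function of
    -- these coefficients.
    obtain ⟨g, hg⟩ := l.exists_leftInverse_of_injective hl
    have h := continuous_moduleTopology_cod g
    have hr : Continuous r := continuous_pi fun S => continuous_apply S.1
    have heq : ⇑N.mkQ = g ∘ r ∘ toConfAlg := by
      funext x
      exact (LinearMap.congr_fun hg (N.mkQ x)).symm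
    rw [heq]
    exact @Continuous.comp _ _ _ (TopologicalSpace.induced toConfAlg Pi.topologicalSpace) _
      (moduleTopology ℝ (LieSpace σ q ⧸ N)) _ _ h
      (@Continuous.comp _ _ _ (TopologicalSpace.induced toConfAlg Pi.topologicalSpace) _ _ _ _ hr
        continuous_induced_dom)

instance : IsTopologicalAddGroup (LieSpace σ q) :=
  isInducing_toConfAlg.topologicalAddGroup toConfAlg

instance : ContinuousSMul ℝ (LieSpace σ q) :=
  isInducing_toConfAlg.continuousSMul continuous_id (map_smul toConfAlg _ _)

instance : T2Space (LieSpace σ q) :=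
  (Topology.IsEmbedding.mk isInducing_toConfAlg toConfAlg_injective).t2Space

/-- The Lie-like condition is a family of linear equations, each involving finitely many
coefficients. -/
theorem isClosedEmbedding_toConfAlg : Topology.IsClosedEmbedding (toConfAlg (σ := σ) (q := q)) := by
  refine ⟨⟨isInducing_toConfAlg, toConfAlg_injective⟩, ?_⟩
  have hr : Set.range (toConfAlg (σ := σ) (q := q)) = {f | ConfAlg.IsLieLike f} :=
    Subtype.range_val
  have h : {f : ConfAlg σ q | ConfAlg.IsLieLike f} =
      ⋂ (m : ℕ) (S : Fin m → Conf σ q),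
        {f | ConfAlg.coproduct m f S = ∑ i, ConfAlg.slot i f S} := by
    ext f
    simp only [Set.mem_iInter]
    exact forall_congr' fun m => funext_iff.trans (forall_congr' fun S => by
      rw [Finset.sum_apply]; rfl)
  rw [hr, h]
  refine isClosed_iInter fun m => isClosed_iInter fun S => isClosed_eq ?_ ?_
  · have : (fun f : ConfAlg σ q => ConfAlg.coproduct m f S) = fun f =>
        ∑ U ∈ (Conf.finite_card_le (σ := σ) (q := q) (∑ i, (S i).card)).toFinset,
          (U.covering S : ℝ) * f U := by
      funext f
      refine finsum_eq_sum_of_support_subset _ fun U hU => ?_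
      rw [Set.Finite.coe_toFinset]
      exact Conf.card_le_of_covering_ne_zero U _ fun h => hU (by simp [h])
    rw [this]
    fun_prop
  · refine continuous_finsetSum _ fun i _ => ?_
    unfold ConfAlg.slot
    split_ifs
    · exact continuous_apply _
    · exact continuous_const

end LieSpace

/-! ### Compact convex sets with dual coordinates -/

section Join

variable {E : Type*} [AddCommGroup E] [Module ℝ E] [TopologicalSpace E]
  {ι : Type*} [DecidableEq ι] {Ω : Set E} {v : ι → E} {κ : ι → E →L[ℝ] ℝ}

theorem coord_nonneg (hΩ : Ω ⊆ closure (convexHull ℝ (Set.range v)))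
    (hκ : ∀ i j, κ i (v j) = if i = j then 1 else 0) {x : E} (hx : x ∈ Ω) (i : ι) : 0 ≤ κ i x := by
  refine closure_minimal (convexHull_min ?_ ?_) ?_ (hΩ hx) (t := {x | 0 ≤ κ i x})
  · rintro _ ⟨j, rfl⟩
    change 0 ≤ κ i (v j)
    rw [hκ]
    split_ifs <;> norm_num
  · exact convex_halfSpace_ge (κ i).isLinear 0
  · exact isClosed_le continuous_const (κ i).continuous

theorem sum_coord_le_one (hΩ : Ω ⊆ closure (convexHull ℝ (Set.range v)))
    (hκ : ∀ i j, κ i (v j) = if i = j then 1 else 0) {x : E} (hx : x ∈ Ω) (F : Finset ι) :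
    ∑ i ∈ F, κ i x ≤ 1 := by
  have h := closure_minimal (convexHull_min ?_ ?_) ?_ (hΩ hx) (t := {x | (∑ i ∈ F, κ i) x ≤ 1})
  · simpa using h
  · rintro _ ⟨j, rfl⟩
    change (∑ i ∈ F, κ i) (v j) ≤ 1
    simp only [sum_apply, hκ, Finset.sum_ite_eq']
    split_ifs <;> norm_num
  · exact convex_halfSpace_le (∑ i ∈ F, κ i).isLinear 1
  · exact isClosed_le (∑ i ∈ F, κ i).continuous continuous_const

variable [ContinuousSMul ℝ E]

/-- Infinite convex combinations of points of a closed convex set belong to the set. -/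
theorem Convex.hasSum_mem {ι : Type*} {s : Set E} (hs : Convex ℝ s) (hcl : IsClosed s)
    {v : ι → E} (hv : ∀ i, v i ∈ s) {w : ι → ℝ} (hw : w ∈ weights ι) {x : E}
    (hx : HasSum (fun i => w i • v i) x) : x ∈ s := by
  have h1 : Filter.Tendsto (fun F : Finset ι => F.centerMass w v) Filter.atTop (nhds x) := by
    -- Partial sums are normalized to genuine convex combinations. The normalizing factor tends to
    -- `1`.
    have := (hw.2.inv₀ one_ne_zero).smul hx
    rwa [inv_one, one_smul] at this
  refine hcl.mem_of_tendsto h1 ?_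
  have h2 : Filter.Tendsto (fun F : Finset ι => ∑ i ∈ F, w i) Filter.atTop (nhds 1) := hw.2
  filter_upwards [h2.eventually_const_lt zero_lt_one] with F hF
  exact hs.centerMass_mem (fun i _ => hw.1 i) hF fun i _ => hv i

variable [IsTopologicalAddGroup E]

/-- The closure of a set containing all rational convex combinations of its points is convex. -/
theorem convex_closure_of_rat {L : Set E} (h : ∀ x ∈ L, ∀ y ∈ L, ∀ a n : ℕ, a ≤ n → 0 < n →
    ((a : ℝ) / n) • x + (1 - (a : ℝ) / n) • y ∈ L) : Convex ℝ (closure L) := by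
  have h1 : ∀ t : ℝ, 0 ≤ t → t ≤ 1 → ∀ x ∈ L, ∀ y ∈ L, t • x + (1 - t) • y ∈ closure L := by
    intro t ht0 ht1 x hx y hy
    have hlim : Filter.Tendsto (fun n : ℕ => ((⌊t * n⌋₊ : ℝ) / n)) Filter.atTop (nhds t) :=
      (tendsto_nat_floor_mul_div_atTop ht0).comp tendsto_natCast_atTop_atTop
    refine mem_closure_of_tendsto
      ((hlim.smul_const x).add ((tendsto_const_nhds.sub hlim).smul_const y)) ?_
    filter_upwards [Filter.eventually_gt_atTop 0] with n hn
    refine h x hx y hy _ n (Nat.floor_le_of_le ?_) hn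
    exact mul_le_of_le_one_left (Nat.cast_nonneg n) ht1
  intro x hx y hy a b ha hb hab
  obtain rfl : b = 1 - a := by linarith
  have hc : Continuous fun p : E × E => a • p.1 + (1 - a) • p.2 := by fun_prop
  have := map_mem_closure hc (closure_prod_eq (s := L) (t := L) ▸ Set.mk_mem_prod hx hy)
    (t := closure L) fun p hp => h1 a ha (by linarith) p.1 hp.1 p.2 hp.2
  rwa [closure_closure] at this

/-- The points of `Ω` with such a `y` include all `v j`, form a convex set, and form a closed set,
being the projection of a compact one. So they exhaust `Ω`. -/
theorem exists_remainder [T2Space E] (hconv : Convex ℝ Ω) (hcomp : IsCompact Ω) (hv : ∀ i, v i ∈ Ω)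
    (hΩ : Ω ⊆ closure (convexHull ℝ (Set.range v)))
    (hκ : ∀ i j, κ i (v j) = if i = j then 1 else 0) {x : E} (hx : x ∈ Ω) (F : Finset ι) :
    ∃ y ∈ Ω, x = ∑ i ∈ F, κ i x • v i + (1 - ∑ i ∈ F, κ i x) • y := by
  let P : E → E → Prop := fun x y => x = ∑ i ∈ F, κ i x • v i + (1 - ∑ i ∈ F, κ i x) • y
  let Z : Set E := {x | x ∈ Ω ∧ ∃ y ∈ Ω, P x y}
  suffices h : closure (convexHull ℝ (Set.range v)) ⊆ Z from (h (hΩ hx)).2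
  refine closure_minimal (convexHull_min ?_ ?_) ?_
  · rintro _ ⟨j, rfl⟩
    -- The remainder of `v j` has weight `0` or `1` according as `j ∈ F` or not, so `v j` itself
    -- serves in both cases.
    refine ⟨hv j, v j, hv j, ?_⟩
    simp only [P, hκ, ite_smul, one_smul, zero_smul, Finset.sum_ite_eq']
    split_ifs <;> simp
  · rintro x₁ ⟨hx₁, y₁, hy₁, h₁⟩ x₂ ⟨hx₂, y₂, hy₂, h₂⟩ a b ha hb hab
    refine ⟨hconv hx₁ hx₂ ha hb hab, ?_⟩
    have hc₁ : 0 ≤ 1 - ∑ i ∈ F, κ i x₁ := sub_nonneg.2 (sum_coord_le_one hΩ hκ hx₁ F)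
    have hc₂ : 0 ≤ 1 - ∑ i ∈ F, κ i x₂ := sub_nonneg.2 (sum_coord_le_one hΩ hκ hx₂ F)
    simp only [P] at h₁ h₂ ⊢
    generalize hc₁' : 1 - ∑ i ∈ F, κ i x₁ = c₁ at *
    generalize hc₂' : 1 - ∑ i ∈ F, κ i x₂ = c₂ at *
    have hc : 1 - ∑ i ∈ F, κ i (a • x₁ + b • x₂) = a * c₁ + b * c₂ := by
      simp only [map_add, map_smul, smul_eq_mul, Finset.sum_add_distrib, ← Finset.mul_sum]
      rw [← hc₁', ← hc₂']
      linear_combination -hab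
    have hsum : a • x₁ + b • x₂ = ∑ i ∈ F, κ i (a • x₁ + b • x₂) • v i +
        ((a * c₁) • y₁ + (b * c₂) • y₂) := by
      simp only [map_add, map_smul, smul_eq_mul, add_smul, mul_smul, Finset.sum_add_distrib,
        ← Finset.smul_sum]
      conv_lhs => rw [h₁, h₂]
      simp only [smul_add]
      abel
    rw [hc]
    have h1 : 0 ≤ a * c₁ := mul_nonneg ha hc₁
    have h2 : 0 ≤ b * c₂ := mul_nonneg hb hc₂
    -- If the combined remainder weight is zero, any point of `Ω` will do. Otherwise the weighted
    -- mean of `y₁` and `y₂` is taken.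
    rcases (add_nonneg h1 h2).eq_or_lt with h0 | h0
    · refine ⟨y₁, hy₁, ?_⟩
      have h1' : a * c₁ = 0 := by linarith
      have h2' : b * c₂ = 0 := by linarith
      rw [h1', h2'] at hsum ⊢
      simpa using hsum
    · refine ⟨((a * c₁) / (a * c₁ + b * c₂)) • y₁ + ((b * c₂) / (a * c₁ + b * c₂)) • y₂,
        hconv hy₁ hy₂ (by positivity) (by positivity) (by field_simp), ?_⟩
      rw [smul_add, smul_smul, smul_smul, mul_div_cancel₀ _ h0.ne', mul_div_cancel₀ _ h0.ne']
      exact hsum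
  · have hZ : Z = Prod.fst '' ((Ω ×ˢ Ω) ∩ {p : E × E | P p.1 p.2}) := by
      ext x
      constructor
      · rintro ⟨hx, y, hy, h⟩
        exact ⟨(x, y), ⟨⟨hx, hy⟩, h⟩, rfl⟩
      · rintro ⟨⟨x, y⟩, ⟨⟨hx, hy⟩, h⟩, rfl⟩
        exact ⟨hx, y, hy, h⟩
    rw [hZ]
    refine (((hcomp.prod hcomp).inter_right ?_).image continuous_fst).isClosed
    exact isClosed_eq continuous_fst (by fun_prop)

/-- Every point of a compact convex set generated by points `v i` with a dual system of functionals
is the sum of its `v`-expansion and a multiple of another point of the set. -/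
theorem exists_expansion [T2Space E] (hconv : Convex ℝ Ω) (hcomp : IsCompact Ω)
    (hv : ∀ i, v i ∈ Ω) (hΩ : Ω ⊆ closure (convexHull ℝ (Set.range v)))
    (hκ : ∀ i j, κ i (v j) = if i = j then 1 else 0)
    (hsum : ∀ w : ι → ℝ, (∀ i, 0 ≤ w i) → Summable w → Summable fun i => w i • v i)
    {x : E} (hx : x ∈ Ω) :
    ∃ c : ℝ, c ≤ 1 ∧ HasSum (fun i => κ i x) c ∧
      ∃ p, HasSum (fun i => κ i x • v i) p ∧ ∃ y ∈ Ω, x = p + (1 - c) • y := by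
  have hpos := coord_nonneg hΩ hκ hx
  have hle := sum_coord_le_one hΩ hκ hx
  have hs : Summable fun i => κ i x := summable_of_sum_le hpos hle
  obtain ⟨c, hc⟩ := hs
  obtain ⟨p, hp⟩ := hsum _ hpos ⟨c, hc⟩
  refine ⟨c, le_of_tendsto' hc hle, hc, p, hp, ?_⟩
  choose y hy hxy using exists_remainder hconv hcomp hv hΩ hκ hx
  -- The remainders `y F` need not converge along `atTop`. Along a finer ultrafilter they do by
  -- compactness, and the limits `c` and `p` are inherited.
  let U : Ultrafilter (Finset ι) := Ultrafilter.of Filter.atTop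
  have hU : (U : Filter (Finset ι)) ≤ Filter.atTop := Ultrafilter.of_le _
  obtain ⟨z, hz, hyz⟩ := isCompact_iff_ultrafilter_le_nhds.1 hcomp (U.map y) (by
    rw [Filter.le_principal_iff]
    exact Filter.univ_mem' (f := (U : Filter (Finset ι))) (s := y ⁻¹' Ω) hy)
  have hyz' : Filter.Tendsto y U (nhds z) := hyz
  refine ⟨z, hz, tendsto_nhds_unique (f := fun _ : Finset ι => x) (l := (U : Filter (Finset ι)))
    tendsto_const_nhds ?_⟩
  have h := (Filter.Tendsto.mono_left hp hU).add
    ((tendsto_const_nhds (x := (1 : ℝ)).sub (Filter.Tendsto.mono_left hc hU)).smul hyz')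
  exact h.congr fun F => (hxy F).symm

end Join

/-! ### The one-vertex configuration -/

namespace Conf

variable {G : Type u}

/-- The configuration with a single vertex. -/
def point (σ : G → G) (q : ℕ) : Conf σ q := mk
  { V := Unit
    fin := inferInstance
    toColored :=
      { graph := ⊥
        color := fun _ _ h => h.elim
        color_symm := fun _ _ h => h.elim }
    valency_le := fun x => by simp [SimpleGraph.neighborSet] }

variable {σ : G → G} {q : ℕ}

theorem card_point : (point σ q).card = 1 := (card_mk _).trans (by simp)

theorem eq_of_card_eq_one {S T : Conf σ q} (hS : S.card = 1) (hT : T.card = 1) : S = T := by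
  obtain ⟨_, ⟨x⟩⟩ := Nat.card_eq_one_iff_unique.1 hS
  obtain ⟨_, ⟨y⟩⟩ := Nat.card_eq_one_iff_unique.1 hT
  have h : ∀ (U : Conf σ q) [Subsingleton U.rep.V] (a b : U.rep.V),
      ¬ U.rep.toColored.graph.Adj a b := fun U _ a b hab => hab.ne (Subsingleton.elim a b)
  rw [← mk_rep S, ← mk_rep T]
  exact mk_eq_mk.2 ⟨⟨⟨fun _ => y, fun _ => x, fun _ => Subsingleton.elim _ _,
    fun _ => Subsingleton.elim _ _⟩, fun {a b} => iff_of_false (h T _ _) (h S _ _)⟩,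
    fun a b hab => absurd hab (h S _ _)⟩

theorem isConnected_point : (point σ q).IsConnected :=
  isConnected_mk.2 (by
    have : Nonempty Unit := inferInstance
    exact ⟨SimpleGraph.Preconnected.of_subsingleton⟩)

theorem growthCoeff_point (T : Conf σ q) : growthCoeff (point σ q) T = T.card := by
  symm
  refine Nat.card_eq_of_bijective (fun x => ⟨{x}, eq_of_card_eq_one ?_ card_point⟩) ⟨?_, ?_⟩
  · rw [card_mk_restrict, Set.ncard_singleton]
  · intro x y h
    exact Set.singleton_injective (congrArg Subtype.val h)
  · rintro ⟨s, hs⟩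
    have h1 : s.ncard = 1 := by rw [← card_mk_restrict, hs, card_point]
    obtain ⟨x, rfl⟩ := Set.ncard_eq_one.1 h1
    exact ⟨x, rfl⟩

theorem natCast_card_ne_zero {T : Conf σ q} (hT : T ≠ 1) : (T.card : ℝ) ≠ 0 :=
  Nat.cast_ne_zero.2 (card_pos hT).ne'

theorem card_npow (T : Conf σ q) (k : ℕ) : (T.npow k).card = k * T.card := by
  induction k with
  | zero => rw [npow, card_one, zero_mul]
  | succ k ih => rw [npow, card_mul, ih, add_mul, one_mul]

end Conf

/-! ### Free energies, convexity and compactness of `Ω` -/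

namespace LieSpace

variable {G : Type u} [Finite G] {σ : G → G} {q : ℕ}

/-- The logarithmic growth function as a Lie-like element. -/
noncomputable def logGrowth (T : Conf σ q) : LieSpace σ q :=
  ⟨ConfAlg.logGrowth T, ConfAlg.logGrowth_mem_lieLike T⟩

theorem toConfAlg_logGrowth (T : Conf σ q) :
    (logGrowth T).toConfAlg = ConfAlg.logGrowth T := rfl

theorem logGrowth_mul (T T' : Conf σ q) : logGrowth (T * T') = logGrowth T + logGrowth T' :=
  toConfAlg_injective (ConfAlg.logGrowth_mul T T')

theorem logGrowth_one : logGrowth (1 : Conf σ q) = 0 := by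
  have h := logGrowth_mul (1 : Conf σ q) 1
  rw [Conf.mul_one'] at h
  exact left_eq_add.1 h

theorem logGrowth_npow (T : Conf σ q) (k : ℕ) : logGrowth (T.npow k) = (k : ℝ) • logGrowth T := by
  induction k with
  | zero => rw [Conf.npow, logGrowth_one, Nat.cast_zero, zero_smul]
  | succ k ih => rw [Conf.npow, logGrowth_mul, ih, Nat.cast_succ, add_smul, one_smul]

/-- The free energy `ℳ(T) / #T`. -/
noncomputable def freeEnergy (T : Conf σ q) : LieSpace σ q := (T.card : ℝ)⁻¹ • logGrowth T

theorem logEDP_eq : logEDP σ q = {x | ∃ T : Conf σ q, T ≠ 1 ∧ x = freeEnergy T} := by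
  ext x
  refine exists_congr fun T => and_congr_right fun _ => ?_
  rw [← toConfAlg_injective.eq_iff, freeEnergy, map_smul, toConfAlg_logGrowth, one_div]

theorem card_smul_freeEnergy (T : Conf σ q) : (T.card : ℝ) • freeEnergy T = logGrowth T := by
  by_cases hT : T = 1
  · rw [hT, Conf.card_one, logGrowth_one, Nat.cast_zero, zero_smul]
  · rw [freeEnergy, smul_smul, mul_inv_cancel₀ (Conf.natCast_card_ne_zero hT), one_smul]

theorem freeEnergy_coeff_point {T : Conf σ q} (hT : T ≠ 1) :
    (freeEnergy T).toConfAlg (Conf.point σ q) = 1 := by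
  rw [freeEnergy, map_smul, toConfAlg_logGrowth, Pi.smul_apply,
    ConfAlg.logGrowth_of_isConnected Conf.isConnected_point, Conf.growthCoeff_point, smul_eq_mul,
    inv_mul_cancel₀ (Conf.natCast_card_ne_zero hT)]

theorem freeEnergy_mem_Omega {T : Conf σ q} (hT : T ≠ 1) : freeEnergy T ∈ Omega σ q :=
  subset_closure (logEDP_eq.symm.subset ⟨T, hT, rfl⟩)

theorem convex_Omega : Convex ℝ (Omega σ q) := by
  refine convex_closure_of_rat ?_
  rw [logEDP_eq]
  rintro _ ⟨T, hT, rfl⟩ _ ⟨T', hT', rfl⟩ a n han hn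
  -- The exponents are chosen so that the two factors contain the fractions `a / n` and `1 - a / n`
  -- of the vertices.
  have hcard : ((T.npow (a * T'.card) * T'.npow ((n - a) * T.card)).card : ℝ) =
      n * T.card * T'.card := by
    rw [Conf.card_mul, Conf.card_npow, Conf.card_npow]
    push_cast [han]
    ring
  have h1 := Conf.natCast_card_ne_zero hT
  have h2 := Conf.natCast_card_ne_zero hT'
  have h3 : (n : ℝ) ≠ 0 := Nat.cast_ne_zero.2 hn.ne'
  refine ⟨T.npow (a * T'.card) * T'.npow ((n - a) * T.card), ?_, ?_⟩
  · intro h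
    rw [h, Conf.card_one, Nat.cast_zero] at hcard
    exact mul_ne_zero (mul_ne_zero h3 h1) h2 hcard.symm
  · simp only [freeEnergy, hcard, logGrowth_mul, logGrowth_npow, smul_add, smul_smul]
    push_cast [han]
    congr 2 <;> field_simp

theorem isCompact_Omega : IsCompact (Omega σ q) := by
  choose C hC using ConfAlg.exists_abs_logGrowth_le (σ := σ) (q := q)
  let B : Set (ConfAlg σ q) := Set.pi Set.univ fun S => Set.Icc (-C S) (C S)
  have hB : IsCompact (toConfAlg ⁻¹' B : Set (LieSpace σ q)) :=
    isClosedEmbedding_toConfAlg.isCompact_preimage (isCompact_univ_pi fun S => isCompact_Icc)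
  refine hB.of_isClosed_subset isClosed_closure (closure_minimal ?_ hB.isClosed)
  rw [logEDP_eq]
  rintro _ ⟨T, hT, rfl⟩ S -
  beta_reduce
  rw [Set.mem_Icc, ← abs_le, freeEnergy, map_smul, toConfAlg_logGrowth, Pi.smul_apply, smul_eq_mul, abs_mul,
    abs_of_nonneg (by positivity), inv_mul_le_iff₀ (by exact_mod_cast Conf.card_pos hT), mul_comm]
  exact hC S T

/-- By additivity, the free energy of a product is the mean of those of its factors, weighted by
their numbers of vertices. -/
theorem Omega_subset_closure_convexHull :
    Omega σ q ⊆ closure (convexHull ℝ (Set.range fun S : Conf₀ σ q => freeEnergy S.1)) := by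
  refine closure_mono ?_
  rw [logEDP_eq]
  rintro _ ⟨T, hT, rfl⟩
  induction h : T.card using Nat.strong_induction_on generalizing T with
  | _ n ih =>
  subst h
  by_cases hc : T.IsConnected
  · exact subset_convexHull _ _ ⟨⟨T, hc⟩, rfl⟩
  obtain ⟨T₁, T₂, h₁, h₂, rfl⟩ := Conf.exists_mul_eq hT hc
  have hp₁ := Conf.card_pos h₁
  have hp₂ := Conf.card_pos h₂
  have hcard := Conf.card_mul T₁ T₂
  have hp : (0 : ℝ) < T₁.card + T₂.card := by positivity
  have heq : freeEnergy (T₁ * T₂) = ((T₁.card : ℝ) / (T₁.card + T₂.card)) • freeEnergy T₁ +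
      ((T₂.card : ℝ) / (T₁.card + T₂.card)) • freeEnergy T₂ := by
    rw [freeEnergy, logGrowth_mul, ← card_smul_freeEnergy T₁, ← card_smul_freeEnergy T₂, hcard,
      smul_add, smul_smul, smul_smul, Nat.cast_add, div_eq_inv_mul, div_eq_inv_mul]
  rw [heq]
  exact convex_convexHull ℝ _ (ih _ (by omega) T₁ h₁ rfl) (ih _ (by omega) T₂ h₂ rfl)
    (by positivity) (by positivity) (by field_simp)

/-! ### Kabi coordinates and absolutely convergent sums -/

theorem continuous_kabi (T : Conf₀ σ q) : Continuous fun x : LieSpace σ q => kabi σ q x T := by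
  have hfin : {S : Conf₀ σ q | S.1.card ≤ T.1.card + T.1.card * q}.Finite :=
    (Conf.finite_card_le (σ := σ) (q := q) (T.1.card + T.1.card * q)).preimage
      (f := fun S : Conf₀ σ q => S.1) Subtype.val_injective.injOn
  have h : (fun x : LieSpace σ q => kabi σ q x T) = fun x => ∑ S ∈ hfin.toFinset,
      (-1 : ℝ) ^ (T.1.card + S.1.card) * (Conf.kabiCoeff T.1 S.1 : ℝ) * x.toConfAlg S.1 := by
    funext x
    refine finsum_eq_sum_of_support_subset _ fun S hS => ?_
    rw [Set.Finite.coe_toFinset]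
    exact Conf.card_le_of_kabiCoeff_ne_zero T.1 S.1 fun h0 => hS (by simp [h0])
  rw [h]
  exact continuous_finsetSum _ fun S _ => continuous_const.mul (continuous_coeff S.1)

open Classical in
theorem kabi_logGrowth (T U : Conf₀ σ q) :
    kabi σ q (logGrowth T.1) U = if U = T then 1 else 0 := by
  rw [← Conf.finsum_kabiCoeff_mul_growthCoeff]
  refine finsum_congr fun S => ?_
  rw [toConfAlg_logGrowth, ConfAlg.logGrowth_of_isConnected S.2]

/-- The component of the kabi map at a connected configuration. -/
noncomputable def kabiCoord (T : Conf₀ σ q) : LieSpace σ q →L[ℝ] ℝ :=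
  ⟨LinearMap.proj T ∘ₗ kabi σ q, continuous_kabi T⟩

theorem kabiCoord_apply (T : Conf₀ σ q) (x : LieSpace σ q) : kabiCoord T x = kabi σ q x T := rfl

/-- Unconditional and absolute summability agree in `ℝ`, and the topology is coefficientwise. -/
theorem isAbsSum_iff {a : Conf₀ σ q → ℝ} {x : LieSpace σ q} :
    IsAbsSum a x ↔ HasSum (fun T : Conf₀ σ q => a T • logGrowth T.1) x := by
  have h : HasSum (fun T : Conf₀ σ q => a T • logGrowth T.1) x ↔ ∀ S : Conf σ q,
      HasSum (fun T : Conf₀ σ q => a T * ConfAlg.logGrowth T.1 S) (x.toConfAlg S) := by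
    rw [← isInducing_toConfAlg.hasSum_iff, Pi.hasSum]
    rfl
  rw [h]
  exact forall_congr' fun S => ⟨fun h => h.2, fun h => ⟨h.summable.abs, h⟩⟩

theorem isAbsSum_div_iff {μ : Conf₀ σ q → ℝ} {x : LieSpace σ q} :
    IsAbsSum (fun S => μ S / (S.1.card : ℝ)) x ↔
      HasSum (fun S : Conf₀ σ q => μ S • freeEnergy S.1) x := by
  rw [isAbsSum_iff]
  simp only [freeEnergy, smul_smul, div_eq_mul_inv]

/-- The kabi coordinates are continuous, so they may be applied term by term. In particular, an
absolutely convergent sum determines its coefficients. -/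
theorem kabi_of_isAbsSum {a : Conf₀ σ q → ℝ} {x : LieSpace σ q} (h : IsAbsSum a x) :
    kabi σ q x = a := by
  classical
  funext U
  have h1 := (isAbsSum_iff.1 h).mapL (kabiCoord U)
  simp only [map_smul, kabiCoord_apply, kabi_logGrowth, smul_eq_mul, mul_ite, mul_one,
    mul_zero] at h1
  have h2 : (fun T => if U = T then a T else 0) = fun T => if T = U then a U else 0 := by
    funext T
    by_cases hT : T = U
    · rw [if_pos hT, if_pos hT.symm, hT]
    · rw [if_neg hT, if_neg (Ne.symm hT)]
  rw [h2] at h1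
  exact h1.unique (hasSum_ite_eq U (a U))

/-- Each coefficient is bounded uniformly over all free energies, and the coefficientwise sum is
again Lie-like because the Lie-like elements are closed. -/
theorem summable_smul_freeEnergy {μ : Conf₀ σ q → ℝ} (h0 : ∀ S, 0 ≤ μ S) (hμ : Summable μ) :
    Summable fun S : Conf₀ σ q => μ S • freeEnergy S.1 := by
  have hS : ∀ S : Conf σ q, Summable fun T : Conf₀ σ q => μ T * (freeEnergy T.1).toConfAlg S := by
    intro S
    obtain ⟨C, hC⟩ := ConfAlg.exists_abs_logGrowth_le (σ := σ) (q := q) S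
    refine Summable.of_norm_bounded (hμ.mul_right C) fun T => ?_
    rw [Real.norm_eq_abs, abs_mul, abs_of_nonneg (h0 T)]
    refine mul_le_mul_of_nonneg_left ?_ (h0 T)
    rw [freeEnergy, map_smul, toConfAlg_logGrowth, Pi.smul_apply, smul_eq_mul, abs_mul,
      abs_of_nonneg (by positivity),
      inv_mul_le_iff₀ (by exact_mod_cast Conf.card_pos T.2.ne_one), mul_comm]
    exact hC T.1
  choose f hf using hS
  have hf' : HasSum (toConfAlg ∘ fun T : Conf₀ σ q => μ T • freeEnergy T.1) f := by
    rw [Pi.hasSum]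
    exact hf
  have hmem : f ∈ Set.range (toConfAlg (σ := σ) (q := q)) := by
    refine isClosedEmbedding_toConfAlg.isClosed_range.mem_of_tendsto hf' ?_
    refine Filter.Eventually.of_forall fun F => ⟨∑ T ∈ F, μ T • freeEnergy T.1, ?_⟩
    rw [map_sum]
    rfl
  obtain ⟨x, rfl⟩ := hmem
  exact ⟨x, (isInducing_toConfAlg.hasSum_iff _ _).1 hf'⟩

/-- `Ω` lies in an affine hyperplane missing `0`. This normalization is what detects the total
weight. -/
theorem coeff_point_of_mem_Omega {x : LieSpace σ q} (hx : x ∈ Omega σ q) :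
    x.toConfAlg (Conf.point σ q) = 1 := by
  refine closure_minimal ?_ (isClosed_eq (continuous_coeff _) continuous_const) hx
  rw [logEDP_eq]
  rintro _ ⟨T, hT, rfl⟩
  exact freeEnergy_coeff_point hT

/-! ### The finite part, the infinite part and their join -/

/-- Every element of `Ω` is the sum of its absolutely convergent part and a multiple of another
element of `Ω`. -/
theorem exists_decomposition {x : LieSpace σ q} (hx : x ∈ Omega σ q) :
    ∃ μ : Conf₀ σ q → ℝ, (∀ S, 0 ≤ μ S) ∧ (∀ S, μ S = S.1.card * kabi σ q x S) ∧
      ∃ c ≤ 1, HasSum μ c ∧ ∃ p, IsAbsSum (fun S => μ S / (S.1.card : ℝ)) p ∧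
        ∃ y ∈ Omega σ q, x = p + (1 - c) • y := by
  classical
  have hv : ∀ S : Conf₀ σ q, freeEnergy S.1 ∈ Omega σ q := fun S =>
    freeEnergy_mem_Omega S.2.ne_one
  -- The factor `#S` turns duality to `ℳ(T)` into duality to `ℳ(T) / #T`.
  have hκ : ∀ S T : Conf₀ σ q, ((S.1.card : ℝ) • kabiCoord S) (freeEnergy T.1) =
      if S = T then 1 else 0 := by
    intro S T
    rw [smul_apply, kabiCoord_apply, freeEnergy, map_smul, Pi.smul_apply,
      kabi_logGrowth]
    split_ifs with h
    · rw [h, smul_eq_mul, smul_eq_mul, mul_one, mul_inv_cancel₀ (Conf.natCast_card_ne_zero T.2.ne_one)]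
    · simp
  obtain ⟨c, hc1, hc, p, hp, y, hy, hxy⟩ := exists_expansion convex_Omega isCompact_Omega hv
    Omega_subset_closure_convexHull hκ (fun _ => summable_smul_freeEnergy) hx
  exact ⟨_, coord_nonneg Omega_subset_closure_convexHull hκ hx, fun S => rfl, c, hc1, hc, p,
    isAbsSum_div_iff.2 hp, y, hy, hxy⟩

theorem mem_OmegaAbs_of_isAbsSum {μ : Conf₀ σ q → ℝ} (hμ : μ ∈ weights (Conf₀ σ q))
    {x : LieSpace σ q} (hx : IsAbsSum (fun S => μ S / (S.1.card : ℝ)) x) : x ∈ OmegaAbs σ q :=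
  ⟨convex_Omega.hasSum_mem isClosed_closure
    (fun S : Conf₀ σ q => freeEnergy_mem_Omega S.2.ne_one) hμ (isAbsSum_div_iff.1 hx), _, hx⟩

theorem weights_eq_of_isAbsSum {μ : Conf₀ σ q → ℝ} {x : LieSpace σ q}
    (hx : IsAbsSum (fun S => μ S / (S.1.card : ℝ)) x) (S : Conf₀ σ q) :
    μ S = S.1.card * kabi σ q x S := by
  rw [kabi_of_isAbsSum hx, mul_div_cancel₀ _ (Conf.natCast_card_ne_zero S.2.ne_one)]

theorem exists_weights_of_mem_OmegaAbs {x : LieSpace σ q} (hx : x ∈ OmegaAbs σ q) :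
    ∃ μ ∈ weights (Conf₀ σ q), IsAbsSum (fun S => μ S / (S.1.card : ℝ)) x := by
  obtain ⟨hΩ, a, ha⟩ := hx
  obtain ⟨μ, h0, hμ, c, -, hc, p, hp, y, hy, hxy⟩ := exists_decomposition hΩ
  have hμa : (fun S => μ S / (S.1.card : ℝ)) = a := by
    funext S
    rw [hμ, kabi_of_isAbsSum ha, mul_div_cancel_left₀ _ (Conf.natCast_card_ne_zero S.2.ne_one)]
  have hpx : p = x := by
    rw [hμa] at hp
    exact (isAbsSum_iff.1 hp).unique (isAbsSum_iff.1 ha)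
  -- What remains is `(1 - c) • y = 0`. The coefficient of `y` at the one-vertex graph is `1`, so `c
  -- = 1`.
  rw [hpx, left_eq_add] at hxy
  have h1 := congrArg (fun z => toConfAlg z (Conf.point σ q)) hxy
  simp only [map_smul, Pi.smul_apply, coeff_point_of_mem_Omega hy, map_zero, Pi.zero_apply,
    smul_eq_mul, mul_one] at h1
  have hc1 : c = 1 := by linarith
  exact ⟨μ, ⟨h0, hc1 ▸ hc⟩, hpx ▸ hp⟩

theorem Omega_eq_join : Omega σ q = join (OmegaAbs σ q) (OmegaInf σ q) := by
  refine Set.Subset.antisymm (fun x hx => ?_) ?_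
  · obtain ⟨μ, h0, hμ, c, hc1, hc, p, hp, y, hy, hxy⟩ := exists_decomposition hx
    have hc0 : 0 ≤ c := hc.nonneg h0
    have hkp : kabi σ q p = kabi σ q x := by
      rw [kabi_of_isAbsSum hp]
      funext S
      rw [hμ, mul_div_cancel_left₀ _ (Conf.natCast_card_ne_zero S.2.ne_one)]
    by_cases h1 : c = 1
    · have hxp : x = p := by rw [hxy, h1, sub_self, zero_smul, add_zero]
      exact Or.inl (Or.inl ⟨hx, hxp ▸ ⟨_, hp⟩⟩)
    -- Since `p` has the same kabi image as `x`, that of `(1 - c) • y` is zero, and `c ≠ 1`.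
    have hyinf : y ∈ OmegaInf σ q := by
      refine ⟨hy, LinearMap.mem_ker.2 ?_⟩
      have h := congrArg (kabi σ q) hxy
      rw [map_add, hkp, left_eq_add, map_smul] at h
      exact (smul_eq_zero.1 h).resolve_left (sub_ne_zero.2 (Ne.symm h1))
    by_cases h2 : c = 0
    · have hμ0 : μ = 0 := (hasSum_zero_iff_of_nonneg h0).1 (h2 ▸ hc)
      have hp0 : p = 0 := by
        refine (isAbsSum_div_iff.1 hp).unique ?_
        simp [hμ0]
      have hxy' : x = y := by rw [hxy, hp0, h2, sub_zero, one_smul, zero_add]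
      exact Or.inl (Or.inr (hxy' ▸ hyinf))
    -- For `0 < c < 1`, rescaling `p` by `c⁻¹` gives weights of total sum `1`, and `x` divides the
    -- segment from `c⁻¹ • p` to `y` with parameter `c`.
    · have hw : (fun S => c⁻¹ * μ S) ∈ weights (Conf₀ σ q) :=
        ⟨fun S => mul_nonneg (inv_nonneg.2 hc0) (h0 S), by
          simpa [inv_mul_cancel₀ h2] using hc.mul_left c⁻¹⟩
      have hp' : IsAbsSum (fun S => c⁻¹ * μ S / (S.1.card : ℝ)) (c⁻¹ • p) := by
        refine isAbsSum_div_iff.2 ?_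
        simpa only [smul_smul] using (isAbsSum_div_iff.1 hp).const_smul c⁻¹
      refine Or.inr ⟨c⁻¹ • p, mem_OmegaAbs_of_isAbsSum hw hp', y, hyinf, c, ⟨hc0, hc1⟩, ?_⟩
      rw [smul_smul, mul_inv_cancel₀ h2, one_smul]
      exact hxy
  · rintro x ((hx | hx) | ⟨p, hp, r, hr, t, ht, rfl⟩)
    · exact hx.1
    · exact hx.1
    · exact convex_Omega hp.1 hr.1 ht.1 (by linarith [ht.2]) (by ring)

theorem disjoint_absConv_atInfinity : Disjoint (absConv σ q) (atInfinity σ q) := by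
  rw [Submodule.disjoint_def]
  rintro x ⟨a, ha⟩ hx
  have ha0 : a = 0 := by rw [← kabi_of_isAbsSum ha]; exact LinearMap.mem_ker.1 hx
  refine (isAbsSum_iff.1 ha).unique ?_
  simp [ha0]

end LieSpace

theorem mainTheorem6 {G : Type*} [Finite G] (σ : G → G) (hσ : Function.Involutive σ) (q : ℕ) :
    -- all `ℳ(T)` are Lie-like, and `Ω` is a compact convex set
    (∀ T : Conf σ q, ConfAlg.logGrowth T ∈ ConfAlg.lieLike σ q) ∧
    IsCompact (LieSpace.Omega σ q) ∧
    Convex ℝ (LieSpace.Omega σ q) ∧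
    -- the two subspaces carrying the two parts of `Ω` form a direct sum
    Disjoint (LieSpace.absConv σ q) (LieSpace.atInfinity σ q) ∧
    -- `Ω` is the join of its finite part and its infinite part
    LieSpace.Omega σ q = join (LieSpace.OmegaAbs σ q) (LieSpace.OmegaInf σ q) ∧
    -- the finite part is the infinite simplex with the vertices `ℳ(S) / #S`, `S` connected
    LieSpace.OmegaAbs σ q =
      {x | ∃ μ ∈ weights (Conf₀ σ q), LieSpace.IsAbsSum (fun S => μ S / (S.1.card : ℝ)) x} ∧
    (∀ μ ∈ weights (Conf₀ σ q),
      ∃ x, LieSpace.IsAbsSum (fun S => μ S / (S.1.card : ℝ)) x) ∧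
    (∀ x ∈ LieSpace.OmegaAbs σ q,
      ∃! μ, μ ∈ weights (Conf₀ σ q) ∧
        LieSpace.IsAbsSum (fun S => μ S / (S.1.card : ℝ)) x) := by
  refine ⟨ConfAlg.logGrowth_mem_lieLike, LieSpace.isCompact_Omega, LieSpace.convex_Omega,
    LieSpace.disjoint_absConv_atInfinity, LieSpace.Omega_eq_join, ?_, ?_, ?_⟩
  · refine Set.Subset.antisymm (fun x hx => LieSpace.exists_weights_of_mem_OmegaAbs hx) ?_
    rintro x ⟨μ, hμ, hx⟩
    exact LieSpace.mem_OmegaAbs_of_isAbsSum hμ hx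
  · intro μ hμ
    obtain ⟨x, hx⟩ := LieSpace.summable_smul_freeEnergy hμ.1 hμ.2.summable
    exact ⟨x, LieSpace.isAbsSum_div_iff.2 hx⟩
  · intro x hx
    obtain ⟨μ, hμ, h⟩ := LieSpace.exists_weights_of_mem_OmegaAbs hx
    refine ⟨μ, ⟨hμ, h⟩, fun ν hν => funext fun S => ?_⟩
    rw [LieSpace.weights_eq_of_isAbsSum h, LieSpace.weights_eq_of_isAbsSum hν.2]
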